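/- **Setting.** Let $\mathfrak g$ be a Kac–Moody algebra (not necessarily symmetrizable) over a field of characteristic $0$, with Cartan subalgebra $\mathfrak h$, linearly independent simple roots $\alpha_i\in\mathfrak h^*$ and simple coroots $\alpha_i^\vee\in\mathfrak h$ ($i\in I$), simple root vectors $e_i$, negative simple root vectors $f_i$, and simple reflections $s_i$. Let $\pi=\{\alpha_i\}_{i\in I}$. Fix a finite or infinite sequence $J=(i_1,i_2,\dots)$ in $I$ such that every $w_j:=s_{i_j}\cdots s_{i_1}$ is a reduced decomposition. For $s\in I$, $m\ge 1$, let $(s,m)$ denote the position $j$ of the $m$-th occurrence of $s$ in $J$, if it exists. Fix $t\in I$, a fundamental weight $\varpi_t$, and an integrable lowest weight module $V(-\varpi_t)$ of lowest weight $-\varpi_t$. *Trails.* The driving trail has weights $\gamma^1_j=-s_t\varpi_t$ for $j\le (t,1)+1$ and $\gamma^1_{j+1}=s_{i_j}\gamma^1_j$ for $j>(t,1)$. A trail $K$ is a sequence of non-zero weight vectors $v^K_j\in V(-\varpi_t)$ of weights $\gamma^K_j$ (with $j=1,2,\dots$, up to $|J|+1$ if $J$ is finite) such that: for every position $j$ of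 $J$ one has $v^K_{j+1}=e_{i_j}^{n_j}v^K_j$ for some $n_j\in\mathbb N$; $\gamma^K_1=-s_t\varpi_t$; $\gamma^K_{j+1}=-w_j\varpi_t$ for all positions $j\ge p$, for some position $p$ of $J$ (one says that $K$ trivializes at such a $p$); and $\gamma^K_j\in\gamma^1_j+\mathbb N\pi$ for every position $j$ of $J$. The face $F_s^{m}$ ($m\ge2$) is the sequence of weights equal to $\alpha_s$ for $(s,m-1)<j\le(s,m)$ and to $0$ otherwise. Adding or removing faces means adding or subtracting these sequences of weights. *The set $T_s^+(\mathbf a)$.* Fix $s\in I$, a position $(s,n)$ of $J$, an initial vector, and an exponent $a_j\in\mathbb N$ for each $j<(s,n)$ with $i_j\ne s$. Then $T_s^+(\mathbf a)$ is the set of trails $K$ with that initial vector that trivialize at $(s,n)$ and satisfy $v^K_{j+1}=e_{i_j}^{a_j}v^K_j$ for all $j<(s,n)$ with $i_j\neq s$; if $s=t$ the driving trail is excluded. A trail $K$ is minimal (resp. maximal) if $f_sv^K_{(s,m)}=0$ (resp. $e_sv^K_{(s,m)+1}=0$) for all $m\ge 1$ for which $(s,m)$ exists. Put $\delta^K_j=\frac12(\gamma^K_j+\gamma^K_{j+1})$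 and $d_m(K)=\alpha_s^\vee(\delta^K_{(s,m)})$, $c_m(K)=-\alpha_s^\vee(\delta^K_{(s,m)})$, both being $0$ if $(s,m)$ does not exist (in particular for $m=0$). **Theorem 4.7.4 (Minimax theorem).** Suppose that $T_s^+(\mathbf a)$ has a maximal trail $K_{\max}$. Then one obtains a minimal trail $K_{\min}\in T_s^+(\mathbf a)$ from $K_{\max}$ by successively removing, one at a time, finitely many faces $F_s^{k+1}$ ($k\ge1$) with $k$ (weakly) increasing, all the intermediate sequences being trails in $T_s^+(\mathbf a)$. Moreover (i) $d_{k+1}(K_{\max})=c_k(K_{\min})$ for all $k\in\mathbb N$; (ii) $K_{\max}=K_{\min}+\sum_{k\ge1}c_k(K_{\min})F_s^{k+1}$, where the $c_k(K_{\min})$ are natural numbers, almost all zero. -/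

import Mathlib

open scoped Classical

namespace Trails

noncomputable section

/-- A realization of a (not necessarily symmetrizable) generalized Cartan matrix on the Cartan
subalgebra `𝔥`: linearly independent simple roots in `𝔥*` and linearly independent simple coroots
in `𝔥`, with `α_j (α_i^∨) = a_{ij}`.  No minimality of the dimension of `𝔥` is imposed. -/
structure Realization (k I 𝔥 : Type*) [Field k] [AddCommGroup 𝔥] [Module k 𝔥] where
  cartan : Matrix I I ℤ
  cartan_diag : ∀ i, cartan i i = 2
  cartan_nonpos : ∀ i j, i ≠ j → cartan i j ≤ 0
  cartan_zero : ∀ i j, cartan i j = 0 → cartan j i = 0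
  root : I → Module.Dual k 𝔥
  coroot : I → 𝔥
  root_coroot : ∀ i j, root j (coroot i) = (cartan i j : k)
  root_indep : LinearIndependent k root
  coroot_indep : LinearIndependent k coroot

/-- Generators of the Kac-Moody algebra: `e_i`, `f_i` for `i ∈ I`, and the elements of `𝔥`. -/
inductive Gen (I 𝔥 : Type*)
  | E : I → Gen I 𝔥
  | F : I → Gen I 𝔥
  | H : 𝔥 → Gen I 𝔥

section KacMoody

variable {k I 𝔥 : Type*} [Field k] [AddCommGroup 𝔥] [Module k 𝔥] (R : Realization k I 𝔥)

/-- The generator `e_i` of the free Lie algebra. -/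
def freeE (_R : Realization k I 𝔥) (i : I) : FreeLieAlgebra k (Gen I 𝔥) :=
  FreeLieAlgebra.of k (Gen.E i)

/-- The generator `f_i` of the free Lie algebra. -/
def freeF (_R : Realization k I 𝔥) (i : I) : FreeLieAlgebra k (Gen I 𝔥) :=
  FreeLieAlgebra.of k (Gen.F i)

/-- The generator of the free Lie algebra given by an element of `𝔥`. -/
def freeH (_R : Realization k I 𝔥) (x : 𝔥) : FreeLieAlgebra k (Gen I 𝔥) :=
  FreeLieAlgebra.of k (Gen.H x)

/-- The defining relations of the auxiliary algebra, as elements of the free Lie algebra: linearity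
of the map from `𝔥`, `[x, y] = 0`, `[x, e_i] = α_i(x) e_i`, `[x, f_i] = -α_i(x) f_i` for `x`, `y`
in `𝔥`, and `[e_i, f_j] = δ_{ij} α_i^∨`. -/
inductive Rel : FreeLieAlgebra k (Gen I 𝔥) → Prop
  | add (x y : 𝔥) : Rel (freeH R (x + y) - freeH R x - freeH R y)
  | smul (c : k) (x : 𝔥) : Rel (freeH R (c • x) - c • freeH R x)
  | hh (x y : 𝔥) : Rel ⁅freeH R x, freeH R y⁆
  | he (x : 𝔥) (i : I) : Rel (⁅freeH R x, freeE R i⁆ - R.root i x • freeE R i)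
  | hf (x : 𝔥) (i : I) : Rel (⁅freeH R x, freeF R i⁆ + R.root i x • freeF R i)
  | ef (i : I) : Rel (⁅freeE R i, freeF R i⁆ - freeH R (R.coroot i))
  | ef_ne (i j : I) (hij : i ≠ j) : Rel ⁅freeE R i, freeF R j⁆

/-- The ideal of the free Lie algebra generated by the defining relations. -/
def relIdeal : LieIdeal k (FreeLieAlgebra k (Gen I 𝔥)) :=
  LieSubmodule.lieSpan k (FreeLieAlgebra k (Gen I 𝔥)) {x | Rel R x}

/-- The auxiliary Lie algebra with the defining relations only. -/
abbrev Aux : Type _ := FreeLieAlgebra k (Gen I 𝔥) ⧸ relIdeal R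

/-- The class in the auxiliary Lie algebra. -/
def auxMk (x : FreeLieAlgebra k (Gen I 𝔥)) : Aux R := LieSubmodule.Quotient.mk x

/-- The largest ideal of the auxiliary Lie algebra meeting `𝔥` trivially, formed as the sum of all
ideals meeting `𝔥` trivially. -/
def radIdeal : LieIdeal k (Aux R) :=
  sSup {J | ∀ x : 𝔥, auxMk R (freeH R x) ∈ J → auxMk R (freeH R x) = 0}

/-- The Kac-Moody algebra. -/
abbrev Alg : Type _ := Aux R ⧸ radIdeal R

/-- The simple root vector `e_i`. -/
def Realization.e (i : I) : Alg R := LieSubmodule.Quotient.mk (auxMk R (freeE R i))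

/-- The simple negative root vector `f_i`. -/
def Realization.f (i : I) : Alg R := LieSubmodule.Quotient.mk (auxMk R (freeF R i))

/-- The element of the Kac-Moody algebra given by an element of the Cartan subalgebra. -/
def Realization.h (x : 𝔥) : Alg R := LieSubmodule.Quotient.mk (auxMk R (freeH R x))

/-- The simple reflection `s_i λ = λ - λ(α_i^∨) α_i` of `𝔥*`. -/
def Realization.refl (i : I) : Module.End k (Module.Dual k 𝔥) :=
  Module.preReflection (R.root i) (Module.Dual.eval k 𝔥 (R.coroot i))

/-- `ϖ` is a fundamental weight for `t`. -/
def IsFundamentalWeight (t : I) (ϖ : Module.Dual k 𝔥) : Prop :=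
  ∀ i, ϖ (R.coroot i) = if i = t then 1 else 0

/-- `V` is an integrable lowest weight module of lowest weight `lam`: it is generated by a nonzero
vector of weight `lam` killed by all `f_i`, and all `e_i`, `f_i` act locally nilpotently. -/
structure IsIntegrableLowestWeight (V : Type*) [AddCommGroup V] [Module k V]
    [LieRingModule (Alg R) V] [LieModule k (Alg R) V] (lam : Module.Dual k 𝔥) : Prop where
  generated : ∃ v : V, v ≠ 0 ∧ (∀ x : 𝔥, ⁅R.h x, v⁆ = lam x • v) ∧ (∀ i, ⁅R.f i, v⁆ = 0) ∧
    LieSubmodule.lieSpan k (Alg R) {v} = ⊤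
  e_nilpotent : ∀ (i : I) (v : V), ∃ n : ℕ, (LieModule.toEnd k (Alg R) V (R.e i) ^ n) v = 0
  f_nilpotent : ∀ (i : I) (v : V), ∃ n : ℕ, (LieModule.toEnd k (Alg R) V (R.f i) ^ n) v = 0

/-- `weyl letter j = s_{letter (j-1)} ⋯ s_{letter 1} s_{letter 0}`. -/
def Realization.weyl (letter : ℕ → I) : ℕ → Module.End k (Module.Dual k 𝔥)
  | 0 => 1
  | j + 1 => R.refl (letter j) * Realization.weyl letter j

/-- A finite or infinite sequence of elements of `I`, all of whose initial segments are reduced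
decompositions.  Steps are numbered from `0`: the step `j < length` applies `letter j` (values of
`letter` beyond `length` are irrelevant), so the `j`-th entry `i_j`, `j ≥ 1`, of the sequence
is `letter (j - 1)`, and `w_j` is `weyl letter j`. -/
structure ReducedSeq where
  length : ℕ∞
  letter : ℕ → I
  reduced : ∀ j : ℕ, (j : ℕ∞) ≤ length → ∀ l : List I,
    (l.map R.refl).prod = R.weyl letter j → j ≤ l.length

variable {R}

/-- `J.Pos s m j`: the step `j` is the `m`-th occurrence (`m ≥ 1`) of `s` in the sequence. -/
def ReducedSeq.Pos (J : ReducedSeq R) (s : I) (m j : ℕ) : Prop :=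
  (j : ℕ∞) < J.length ∧ J.letter j = s ∧ {i | i < j ∧ J.letter i = s}.ncard + 1 = m

/-- The weights of the driving trail: constant equal to `-s_t ϖ` up to and including the first step
with letter `t`, and reflected at every later step.  The value at `j` is the weight before
the step `j`. -/
def ReducedSeq.driving (J : ReducedSeq R) (t : I) (ϖ : Module.Dual k 𝔥) :
    ℕ → Module.Dual k 𝔥
  | 0 => -(R.refl t ϖ)
  | j + 1 => if ∃ i < j, J.letter i = t then R.refl (J.letter j) (ReducedSeq.driving J t ϖ j)
      else ReducedSeq.driving J t ϖ j

/-- The weights of the face `F_s^m` (`m ≥ 2`): if `u`, `v` are the `m`-th and `(m-1)`-th occurrences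
of `s`, the value is `α_s` for `v < j ≤ u` and `0` otherwise. -/
def ReducedSeq.face (J : ReducedSeq R) (s : I) (m j : ℕ) : Module.Dual k 𝔥 :=
  if ∃ u v l, J.Pos s m u ∧ J.Pos s l v ∧ l + 1 = m ∧ v < j ∧ j ≤ u then R.root s else 0

/-- Trails associated to `t` in the module `V` of lowest weight `-ϖ`.  The vector `vec j` of weight
`wt j` is the one before the step `j`, for `j ≤ J.length`; later values are irrelevant. -/
structure Trail (J : ReducedSeq R) (t : I) (ϖ : Module.Dual k 𝔥) (V : Type*) [AddCommGroup V]
    [Module k V] [LieRingModule (Alg R) V] [LieModule k (Alg R) V] where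
  vec : ℕ → V
  wt : ℕ → Module.Dual k 𝔥
  vec_ne_zero : ∀ j : ℕ, (j : ℕ∞) ≤ J.length → vec j ≠ 0
  weight : ∀ j : ℕ, (j : ℕ∞) ≤ J.length → ∀ x : 𝔥, ⁅R.h x, vec j⁆ = wt j x • vec j
  step : ∀ j : ℕ, (j : ℕ∞) < J.length → ∃ n : ℕ,
    (LieModule.toEnd k (Alg R) V (R.e (J.letter j)) ^ n) (vec j) = vec (j + 1)
  start : wt 0 = -(R.refl t ϖ)
  boundary : ∃ m : ℕ, (m : ℕ∞) < J.length ∧ ∀ j : ℕ, m ≤ j → (j : ℕ∞) < J.length →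
    wt (j + 1) = -(R.weyl J.letter (j + 1) ϖ)
  positive : ∀ j : ℕ, (j : ℕ∞) < J.length →
    wt j - J.driving t ϖ j ∈ AddSubmonoid.closure (Set.range R.root)

namespace Trail

variable {J : ReducedSeq R} {t : I} {ϖ : Module.Dual k 𝔥} {V : Type*} [AddCommGroup V]
    [Module k V] [LieRingModule (Alg R) V] [LieModule k (Alg R) V]

/-- The trail trivializes at the step `m`: after every step `j ≥ m` its weight is the extremal
weight `-w ϖ`, with `w` the product of the simple reflections of the steps `0, …, j`. -/
def TrivializesAt (K : Trail J t ϖ V) (m : ℕ) : Prop :=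
  ∀ j : ℕ, m ≤ j → (j : ℕ∞) < J.length → K.wt (j + 1) = -(R.weyl J.letter (j + 1) ϖ)

/-- The trail is the driving trail. -/
def IsDriving (K : Trail J t ϖ V) : Prop :=
  ∀ j : ℕ, (j : ℕ∞) ≤ J.length → K.wt j = J.driving t ϖ j

/-- A trail is minimal (of type `s`) if its vector before each step of letter `s` is killed
by `f_s`. -/
def IsMinimal (K : Trail J t ϖ V) (s : I) : Prop :=
  ∀ m j : ℕ, J.Pos s m j → ⁅R.f s, K.vec j⁆ = 0

/-- A trail is maximal (of type `s`) if its vector after each step of letter `s` is killed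
by `e_s`. -/
def IsMaximal (K : Trail J t ϖ V) (s : I) : Prop :=
  ∀ m j : ℕ, J.Pos s m j → ⁅R.e s, K.vec (j + 1)⁆ = 0

/-- `d_m = α_s^∨(δ_{(s,m)})`, where `(s,m)` is the `m`-th occurrence of `s` and `δ_j` is the mean of
the weights before and after the step `j`; it is `0` if there is no `m`-th occurrence of `s`,
in particular for `m = 0`. -/
def d (K : Trail J t ϖ V) (s : I) (m : ℕ) : k :=
  if H : ∃ j, J.Pos s m j then
    ((2 : k)⁻¹ • (K.wt H.choose + K.wt (H.choose + 1))) (R.coroot s)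
  else 0

/-- `c_m = - α_s^∨(δ_{(s,m)})`, with the same convention. -/
def c (K : Trail J t ϖ V) (s : I) (m : ℕ) : k := -K.d s m

/-- `K'` is obtained from `K` by removing one copy of the (existing) face `F_s^m`. -/
def RemoveFace (K K' : Trail J t ϖ V) (s : I) (m : ℕ) : Prop :=
  2 ≤ m ∧ (∃ u, J.Pos s m u) ∧
    ∀ j : ℕ, (j : ℕ∞) ≤ J.length → K.wt j = K'.wt j + J.face s m j

end Trail

/-- The set `T_s^+`.  It is determined by `s`, by the number `n` for which the step `(s,n)` (the
`n`-th occurrence of `s`) is the one where the trails are to be trivial, and by what is held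
fixed: the initial vector `v₀` and the exponents `a i` of the simple root vectors other than `e_s`
at the steps before `(s,n)`.  The driving trail is excluded if `s = t`. -/
def TPlus (J : ReducedSeq R) (t : I) (ϖ : Module.Dual k 𝔥) {V : Type*} [AddCommGroup V]
    [Module k V] [LieRingModule (Alg R) V] [LieModule k (Alg R) V]
    (s : I) (n : ℕ) (v₀ : V) (a : ℕ → ℕ) : Set (Trail J t ϖ V) :=
  {K | (s ≠ t ∨ ¬ K.IsDriving) ∧ K.vec 0 = v₀ ∧ ∃ p : ℕ, J.Pos s n p ∧ K.TrivializesAt p ∧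
    ∀ i < p, J.letter i ≠ s →
      (LieModule.toEnd k (Alg R) V (R.e (J.letter i)) ^ a i) (K.vec i) = K.vec (i + 1)}

/-- `K'` is obtained from `K` inside the set `T` of trails by removing one at a time faces
`F_s^{κ+1}`, `κ ≥ 1`, with `κ` (weakly) increasing. -/
def ObtainedByRemovingFaces {J : ReducedSeq R} {t : I} {ϖ : Module.Dual k 𝔥} {V : Type*}
    [AddCommGroup V] [Module k V] [LieRingModule (Alg R) V] [LieModule k (Alg R) V]
    (T : Set (Trail J t ϖ V)) (s : I) (K K' : Trail J t ϖ V) : Prop :=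
  ∃ (r : ℕ) (L : ℕ → Trail J t ϖ V) (κ : ℕ → ℕ), L 0 = K ∧ L r = K' ∧ Monotone κ ∧
    (∀ a ≤ r, L a ∈ T) ∧ ∀ a < r, 1 ≤ κ a ∧ (L a).RemoveFace (L (a + 1)) s (κ a + 1)

end KacMoody

end

end Trails

/-! The heart is an `𝔰𝔩₂`-string computation for the triple attached to `s`. Let `y` be the vector
before an occurrence of `s`, and suppose that `e ^ n y` is nonzero and killed by `e`. Then `e ^ (n +
1) (f y) = (n + 1) d e ^ n y`, where `d` is the mean of the `α_s^∨`-weights of `y` and `e ^ n y`;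
integrability makes `d` a natural number, and `f y = 0` exactly when `d = 0`
(`Sl2Ops.exists_nat_add`, `Sl2Ops.f_eq_zero_iff`). So where a trail is maximal, being minimal as
well means `d_m = 0`.

A face `F_s^{κ+1}` is removed by applying `f_s` to the vectors between the `κ`-th and the next
occurrence of `s`. The steps in between use `e_i` with `i ≠ s`, which commute with `f_s`. At the
`κ`-th occurrence the vector before the step is killed by `f_s`, so `f_s e_s ^ (n + 1) y` is a
multiple of `e_s ^ n y`; at the next one maximality makes `e_s ^ (n + 1) f_s y` a nonzero multiple
of `e_s ^ n y`. After rescaling this is a trail (`MinimalUpTo.exists_removeFace`), with `d_{κ+1}`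
lowered by one and the later `d_m` unchanged. Doing this `d_{κ+1}` times and then increasing `κ`
ends at a minimal trail (`MinimalUpTo.exists_minimal`). The process can start because `f_s` kills
the vector before the first occurrence of `s`, the driving trail being excluded when `s = t`
(`Trail.opF_first_eq_zero`). As `F_s^{l+1}` adds one to both `d_l` and `d_{l+1}`, the identities for
`c_m` follow by comparison.

The altered sequence must also stay above the driving trail. This is automatic: a sequence of
raising steps that ends at an extremal weight lies above the extremal weights `-w_j ϖ` throughout,
since from each of its vectors one can descend to the extremal weight by operators `f_i`
(`sub_weyl_mem_cone`). The input is that a reduced sequence has `w_j⁻¹ α_{i_{j+1}}` positive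
(`Realization.apply_root_mem_cone`). -/

namespace Trails

/-! ### Weight strings of integrable `𝔰𝔩₂`-operators. -/

section Sl2

variable {k V : Type*} [Field k] [AddCommGroup V] [Module k V]

/-- The operators `h`, `e`, `f` satisfy the commutation relations of `𝔰𝔩₂`. -/
structure Sl2Ops (h e f : Module.End k V) : Prop where
  ef : ∀ v, e (f v) = f (e v) + h v
  he : ∀ v, h (e v) = e (h v) + (2 : k) • e v
  hf : ∀ v, h (f v) = f (h v) - (2 : k) • f v

namespace Sl2Ops

variable {h e f : Module.End k V}

theorem swap (S : Sl2Ops h e f) : Sl2Ops (-h) f e where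
  ef v := by rw [S.ef]; simp
  he v := by simp [S.hf]; abel
  hf v := by simp [S.he]; abel

theorem h_pow_e (S : Sl2Ops h e f) {v : V} {w : k} (hv : h v = w • v) (n : ℕ) :
    h ((e ^ n) v) = (w + 2 * n) • (e ^ n) v := by
  induction n with
  | zero => simp [hv]
  | succ n ih =>
    rw [pow_succ', Module.End.mul_apply, S.he, ih]
    simp only [map_smul, Nat.cast_succ]
    module

theorem h_pow_f (S : Sl2Ops h e f) {v : V} {w : k} (hv : h v = w • v) (n : ℕ) :
    h ((f ^ n) v) = (w - 2 * n) • (f ^ n) v := by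
  have := S.swap.h_pow_e (v := v) (w := -w) (by simp [hv]) n
  rw [LinearMap.neg_apply, neg_eq_iff_eq_neg] at this
  rw [this]; module

theorem pow_e_f (S : Sl2Ops h e f) {v : V} {w : k} (hv : h v = w • v) (n : ℕ) :
    (e ^ (n + 1)) (f v) = f ((e ^ (n + 1)) v) + ((n + 1) * (w + n)) • (e ^ n) v := by
  induction n with
  | zero => simp [S.ef, hv]
  | succ n ih =>
    rw [pow_succ' e (n + 1), Module.End.mul_apply, ih, map_add, S.ef, map_smul, S.h_pow_e hv,
      Module.End.mul_apply, pow_succ' e n, Module.End.mul_apply]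
    push_cast
    module

theorem pow_f_e (S : Sl2Ops h e f) {v : V} {w : k} (hv : h v = w • v) (n : ℕ) :
    (f ^ (n + 1)) (e v) = e ((f ^ (n + 1)) v) + ((n + 1) * (-w + n)) • (f ^ n) v :=
  S.swap.pow_e_f (by simp [hv]) n

theorem f_pow_e (S : Sl2Ops h e f) {y : V} {w : k} (hy : h y = w • y) (hf : f y = 0) (n : ℕ) :
    f ((e ^ (n + 1)) y) = -((n + 1) * (w + n)) • (e ^ n) y := by
  have := S.pow_e_f hy n
  rw [hf, map_zero] at this
  rw [neg_smul]
  exact eq_neg_of_add_eq_zero_left this.symm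

variable [CharZero k]

/-- The hypotheses pass from `v` to `e v` with `m + 2` and `q + 1`, so induction on the nilpotency
order `r` gives `e v = 0`. For a highest weight vector, `f ^ (q + 1) v = 0` forces `(q + 1) (q - m)
f ^ q v = 0`, and the scalar is nonzero while `q < m`; this descends to `v = 0`. -/
theorem eq_zero_of_pow_f_eq_zero (S : Sl2Ops h e f) {r : ℕ} {v : V} {m q : ℕ}
    (hv : h v = (m : k) • v) (hq : q ≤ m) (hf : (f ^ q) v = 0) (he : (e ^ r) v = 0) : v = 0 := by
  induction r generalizing v m q with
  | zero => simpa using he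
  | succ r ih =>
    have h1 : e v = 0 := by
      refine ih (m := m + 2) (q := q + 1) ?_ (by omega) ?_ ?_
      · have := S.h_pow_e hv 1
        simp only [pow_one] at this
        rw [this]; push_cast; module
      · rw [S.pow_f_e hv, pow_succ', Module.End.mul_apply, hf]; simp
      · simpa [pow_succ] using he
    clear he
    induction q with
    | zero => simpa using hf
    | succ q ihq =>
      refine ihq (by omega) ?_
      have h2 := S.pow_f_e hv q
      rw [h1, hf, map_zero, map_zero, zero_add] at h2
      refine (smul_eq_zero.1 h2.symm).resolve_left ?_
      have h3 : (q : k) + 1 ≠ 0 := by exact_mod_cast Nat.succ_ne_zero q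
      have h4 : (-(m : k) + q) ≠ 0 := by
        intro h
        have : (m : k) = q := by linear_combination -h
        have : m = q := by exact_mod_cast this
        omega
      exact mul_ne_zero h3 h4

theorem eq_zero_of_pow_e_eq_zero (S : Sl2Ops h e f) {r : ℕ} {v : V} {m q : ℕ}
    (hv : h v = -(m : k) • v) (hq : q ≤ m) (he : (e ^ q) v = 0) (hf : (f ^ r) v = 0) : v = 0 :=
  S.swap.eq_zero_of_pow_f_eq_zero (by simp [hv]) hq he hf

theorem exists_nat_of_e_eq_zero (S : Sl2Ops h e f) {r : ℕ} {v : V} {w : k}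
    (hv : h v = w • v) (h0 : v ≠ 0) (he : e v = 0) (hf : (f ^ r) v = 0) : ∃ l : ℕ, w = l := by
  induction r with
  | zero => exact absurd (by simpa using hf) h0
  | succ r ih =>
    by_cases h1 : (f ^ r) v = 0
    · exact ih h1
    · have h2 := S.pow_f_e hv r
      rw [he, hf, map_zero, map_zero, zero_add] at h2
      have h3 := (smul_eq_zero.1 h2.symm).resolve_right h1
      have h4 : (r : k) + 1 ≠ 0 := by exact_mod_cast Nat.succ_ne_zero r
      exact ⟨r, by linear_combination -(mul_eq_zero.1 h3).resolve_left h4⟩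

/-- If `e ^ n y` is a highest weight vector and `y` has weight `w`, then `w + n` is a natural
number. -/
theorem exists_nat_add (S : Sl2Ops h e f) (hf : ∀ v, ∃ r : ℕ, (f ^ r) v = 0) {y : V} {w : k}
    {n : ℕ} (hy : h y = w • y) (h0 : (e ^ n) y ≠ 0) (h1 : e ((e ^ n) y) = 0) :
    ∃ x : ℕ, w + n = x := by
  obtain ⟨r, hr⟩ := hf ((e ^ n) y)
  obtain ⟨l, hl⟩ := S.exists_nat_of_e_eq_zero (S.h_pow_e hy n) h0 h1 hr
  have hw : w = l - 2 * n := by linear_combination hl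
  by_cases hn : n ≤ l
  · exact ⟨l - n, by rw [hw, Nat.cast_sub hn]; ring⟩
  -- For `n > l` the weight `w = -(2n - l)` is so negative that `e ^ (n + 1)` would be injective on
  -- its vectors, although it kills `y`.
  · obtain ⟨r, hr⟩ := hf y
    have : y = 0 := by
      refine S.eq_zero_of_pow_e_eq_zero (m := 2 * n - l) (q := n + 1) ?_ (by omega) ?_ hr
      · rw [hy, hw, Nat.cast_sub (by omega)]; push_cast; congr 1; ring
      · rw [pow_succ']; exact h1
    simp [this] at h0

/-- The commutator formula reduces to `e ^ (n + 1) (f y) = (n + 1) (w + n) e ^ n y`. If `w + n = 0`,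
then `f y` has weight `-(n + 2)` and `e ^ (n + 1)` kills it, which leaves only zero. Note that `w +
n` is the mean of `w` and `w + 2n`. -/
theorem f_eq_zero_iff (S : Sl2Ops h e f) (hf : ∀ v, ∃ r : ℕ, (f ^ r) v = 0) {y : V} {w : k}
    {n : ℕ} (hy : h y = w • y) (h0 : (e ^ n) y ≠ 0) (h1 : e ((e ^ n) y) = 0) :
    f y = 0 ↔ w + n = 0 := by
  have h2 := S.pow_e_f hy n
  have h3 : (e ^ (n + 1)) y = 0 := by rw [pow_succ']; exact h1
  rw [h3, map_zero, zero_add] at h2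
  constructor
  · intro h
    rw [h, map_zero] at h2
    have h4 : (n : k) + 1 ≠ 0 := by exact_mod_cast Nat.succ_ne_zero n
    exact (mul_eq_zero.1 ((smul_eq_zero.1 h2.symm).resolve_right h0)).resolve_left h4
  · intro h
    rw [h, mul_zero, zero_smul] at h2
    obtain ⟨r, hr⟩ := hf (f y)
    refine S.eq_zero_of_pow_e_eq_zero (m := n + 2) (q := n + 1) ?_ (by omega) h2 hr
    have := S.h_pow_f hy 1
    simp only [pow_one] at this
    rw [this, eq_neg_of_add_eq_zero_left h]; push_cast; module

end Sl2Ops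

end Sl2

end Trails

namespace Trails

noncomputable section

/-! ### Relations of the Kac–Moody algebra, weight spaces, and reflection invariance of the weights.
-/

section Weights

variable {k I 𝔥 : Type*} [Field k] [AddCommGroup 𝔥] [Module k 𝔥] {R : Realization k I 𝔥}

namespace Realization

theorem lie_h_e (x : 𝔥) (i : I) : ⁅R.h x, R.e i⁆ = R.root i x • R.e i := by
  have h1 : (LieSubmodule.Quotient.mk (⁅freeH R x, freeE R i⁆ - R.root i x • freeE R i) : Aux R) = 0 :=
    LieSubmodule.Quotient.mk_eq_zero'.2 (LieSubmodule.subset_lieSpan (Rel.he x i))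
  have h2 : (⁅auxMk R (freeH R x), auxMk R (freeE R i)⁆ : Aux R) = R.root i x • auxMk R (freeE R i) :=
    sub_eq_zero.1 h1
  exact congrArg (fun y : Aux R => (LieSubmodule.Quotient.mk y : Alg R)) h2

theorem lie_h_f (x : 𝔥) (i : I) : ⁅R.h x, R.f i⁆ = -(R.root i x • R.f i) := by
  have h1 : (LieSubmodule.Quotient.mk (⁅freeH R x, freeF R i⁆ + R.root i x • freeF R i) : Aux R) = 0 :=
    LieSubmodule.Quotient.mk_eq_zero'.2 (LieSubmodule.subset_lieSpan (Rel.hf x i))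
  have h2 : (⁅auxMk R (freeH R x), auxMk R (freeF R i)⁆ : Aux R) = -(R.root i x • auxMk R (freeF R i)) :=
    eq_neg_of_add_eq_zero_left h1
  exact congrArg (fun y : Aux R => (LieSubmodule.Quotient.mk y : Alg R)) h2

theorem lie_e_f (i : I) : ⁅R.e i, R.f i⁆ = R.h (R.coroot i) := by
  have h1 : (LieSubmodule.Quotient.mk (⁅freeE R i, freeF R i⁆ - freeH R (R.coroot i)) : Aux R) = 0 :=
    LieSubmodule.Quotient.mk_eq_zero'.2 (LieSubmodule.subset_lieSpan (Rel.ef i))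
  have h2 : (⁅auxMk R (freeE R i), auxMk R (freeF R i)⁆ : Aux R) = auxMk R (freeH R (R.coroot i)) :=
    sub_eq_zero.1 h1
  exact congrArg (fun y : Aux R => (LieSubmodule.Quotient.mk y : Alg R)) h2

theorem lie_e_f_of_ne {i j : I} (hij : i ≠ j) : ⁅R.e i, R.f j⁆ = 0 := by
  have h1 : (LieSubmodule.Quotient.mk (⁅freeE R i, freeF R j⁆) : Aux R) = 0 :=
    LieSubmodule.Quotient.mk_eq_zero'.2 (LieSubmodule.subset_lieSpan (Rel.ef_ne i j hij))
  have h2 : (⁅auxMk R (freeE R i), auxMk R (freeF R j)⁆ : Aux R) = 0 := h1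
  exact congrArg (fun y : Aux R => (LieSubmodule.Quotient.mk y : Alg R)) h2

theorem lie_h_h (x y : 𝔥) : ⁅R.h x, R.h y⁆ = 0 := by
  have h1 : (LieSubmodule.Quotient.mk (⁅freeH R x, freeH R y⁆) : Aux R) = 0 :=
    LieSubmodule.Quotient.mk_eq_zero'.2 (LieSubmodule.subset_lieSpan (Rel.hh x y))
  have h2 : (⁅auxMk R (freeH R x), auxMk R (freeH R y)⁆ : Aux R) = 0 := h1
  exact congrArg (fun y : Aux R => (LieSubmodule.Quotient.mk y : Alg R)) h2

theorem root_coroot_self (i : I) : R.root i (R.coroot i) = 2 := by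
  rw [R.root_coroot, R.cartan_diag]; norm_num

theorem refl_apply (i : I) (mu : Module.Dual k 𝔥) :
    R.refl i mu = mu - mu (R.coroot i) • R.root i := by
  simp [Realization.refl, Module.preReflection_apply]

theorem refl_refl (i : I) (mu : Module.Dual k 𝔥) : R.refl i (R.refl i mu) = mu := by
  simp only [refl_apply, LinearMap.sub_apply, LinearMap.smul_apply, root_coroot_self, smul_eq_mul]
  module

theorem refl_mul_refl (i : I) : R.refl i * R.refl i = 1 := LinearMap.ext (refl_refl i)

/-- The operator on a module given by `e_i`. -/
abbrev opE (R : Realization k I 𝔥) (V : Type*) [AddCommGroup V] [Module k V]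
    [LieRingModule (Alg R) V] [LieModule k (Alg R) V] (i : I) : Module.End k V :=
  LieModule.toEnd k (Alg R) V (R.e i)

/-- The operator on a module given by `f_i`. -/
abbrev opF (R : Realization k I 𝔥) (V : Type*) [AddCommGroup V] [Module k V]
    [LieRingModule (Alg R) V] [LieModule k (Alg R) V] (i : I) : Module.End k V :=
  LieModule.toEnd k (Alg R) V (R.f i)

/-- The operator on a module given by an element of the Cartan subalgebra. -/
abbrev opH (R : Realization k I 𝔥) (V : Type*) [AddCommGroup V] [Module k V]
    [LieRingModule (Alg R) V] [LieModule k (Alg R) V] (x : 𝔥) : Module.End k V :=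
  LieModule.toEnd k (Alg R) V (R.h x)

/-- The submonoid generated by the simple roots. -/
abbrev cone (R : Realization k I 𝔥) : AddSubmonoid (Module.Dual k 𝔥) :=
  AddSubmonoid.closure (Set.range R.root)

theorem root_mem_cone (i : I) : R.root i ∈ R.cone :=
  AddSubmonoid.subset_closure ⟨i, rfl⟩

end Realization

variable {V : Type*} [AddCommGroup V] [Module k V] [LieRingModule (Alg R) V]
  [LieModule k (Alg R) V]

open Realization

theorem opE_opF (i : I) (v : V) :
    R.opE V i (R.opF V i v) = R.opF V i (R.opE V i v) + R.opH V (R.coroot i) v := by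
  simp only [LieModule.toEnd_apply_apply]
  rw [leibniz_lie, lie_e_f, add_comm]

theorem opE_opF_of_ne {i j : I} (hij : i ≠ j) (v : V) :
    R.opE V i (R.opF V j v) = R.opF V j (R.opE V i v) := by
  simp only [LieModule.toEnd_apply_apply]
  rw [leibniz_lie, lie_e_f_of_ne hij, zero_lie, zero_add]

theorem opH_opE (x : 𝔥) (i : I) (v : V) :
    R.opH V x (R.opE V i v) = R.opE V i (R.opH V x v) + R.root i x • R.opE V i v := by
  simp only [LieModule.toEnd_apply_apply]
  rw [leibniz_lie, lie_h_e, smul_lie, add_comm]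

theorem opH_opF (x : 𝔥) (i : I) (v : V) :
    R.opH V x (R.opF V i v) = R.opF V i (R.opH V x v) - R.root i x • R.opF V i v := by
  simp only [LieModule.toEnd_apply_apply]
  rw [leibniz_lie, lie_h_f, neg_lie, smul_lie, add_comm, sub_eq_add_neg]

theorem opH_opH (x y : 𝔥) (v : V) :
    R.opH V x (R.opH V y v) = R.opH V y (R.opH V x v) := by
  simp only [LieModule.toEnd_apply_apply]
  rw [leibniz_lie, lie_h_h, zero_lie, zero_add]

theorem pow_opE_opF_of_ne {i j : I} (hij : i ≠ j) (n : ℕ) (v : V) :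
    (R.opE V i ^ n) (R.opF V j v) = R.opF V j ((R.opE V i ^ n) v) := by
  induction n with
  | zero => simp
  | succ n ih => rw [pow_succ', Module.End.mul_apply, ih, opE_opF_of_ne hij, Module.End.mul_apply]

variable (R V) in
theorem sl2Ops (i : I) : Sl2Ops (R.opH V (R.coroot i)) (R.opE V i) (R.opF V i) where
  ef := opE_opF i
  he v := by rw [opH_opE, root_coroot_self]
  hf v := by rw [opH_opF, root_coroot_self]

/-- The weight space of weight `mu`. -/
def wtSpace (R : Realization k I 𝔥) (V : Type*) [AddCommGroup V] [Module k V]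
    [LieRingModule (Alg R) V] [LieModule k (Alg R) V] (mu : Module.Dual k 𝔥) : Submodule k V where
  carrier := {v | ∀ x, R.opH V x v = mu x • v}
  add_mem' hv hw x := by rw [map_add, hv x, hw x, smul_add]
  zero_mem' x := by simp
  smul_mem' c v hv x := by rw [map_smul, hv x, smul_comm]

theorem mem_wtSpace {mu : Module.Dual k 𝔥} {v : V} :
    v ∈ wtSpace R V mu ↔ ∀ x, R.opH V x v = mu x • v := Iff.rfl

theorem opE_mem_wtSpace {mu : Module.Dual k 𝔥} {v : V} (hv : v ∈ wtSpace R V mu) (i : I) :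
    R.opE V i v ∈ wtSpace R V (mu + R.root i) := fun x => by
  rw [opH_opE, hv x, map_smul, LinearMap.add_apply, add_smul]

theorem opF_mem_wtSpace {mu : Module.Dual k 𝔥} {v : V} (hv : v ∈ wtSpace R V mu) (i : I) :
    R.opF V i v ∈ wtSpace R V (mu - R.root i) := fun x => by
  rw [opH_opF, hv x, map_smul, LinearMap.sub_apply, sub_smul]

theorem pow_opE_mem_wtSpace {mu : Module.Dual k 𝔥} {v : V} (hv : v ∈ wtSpace R V mu) (i : I)
    (n : ℕ) : (R.opE V i ^ n) v ∈ wtSpace R V (mu + n • R.root i) := by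
  induction n with
  | zero => simpa using hv
  | succ n ih =>
    rw [pow_succ', Module.End.mul_apply, succ_nsmul, ← add_assoc]
    exact opE_mem_wtSpace ih i

theorem pow_opF_mem_wtSpace {mu : Module.Dual k 𝔥} {v : V} (hv : v ∈ wtSpace R V mu) (i : I)
    (n : ℕ) : (R.opF V i ^ n) v ∈ wtSpace R V (mu - n • R.root i) := by
  induction n with
  | zero => simpa using hv
  | succ n ih =>
    rw [pow_succ', Module.End.mul_apply, succ_nsmul, ← sub_sub]
    exact opF_mem_wtSpace ih i

theorem wt_unique {mu nu : Module.Dual k 𝔥} {v : V} (h0 : v ≠ 0) (hm : v ∈ wtSpace R V mu)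
    (hn : v ∈ wtSpace R V nu) : mu = nu := by
  ext x
  have := (hm x).symm.trans (hn x)
  exact smul_left_injective k h0 this

theorem iSupIndep_wtSpace : iSupIndep (wtSpace R V) := by
  have h1 := Module.End.independent_iInf_maxGenEigenspace_of_forall_mapsTo (R.opH V) (by
    intro x y φ
    exact Module.End.mapsTo_maxGenEigenspace_of_comm (LinearMap.ext fun v => opH_opH y x v) φ)
  refine (h1.comp (f := fun (mu : Module.Dual k 𝔥) (x : 𝔥) => mu x) DFunLike.coe_injective).mono ?_
  intro mu v hv
  simp only [Function.comp, Submodule.mem_iInf]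
  intro x
  exact (Module.End.mem_maxGenEigenspace _ _ _).2 ⟨1, by simp [hv x]⟩

/-- A submodule stable under the generators of the Kac-Moody algebra is stable under the whole
algebra. -/
theorem lie_mem_of_stable (N : Submodule k V) (hE : ∀ i, ∀ v ∈ N, R.opE V i v ∈ N)
    (hF : ∀ i, ∀ v ∈ N, R.opF V i v ∈ N) (hH : ∀ x, ∀ v ∈ N, R.opH V x v ∈ N)
    (y : Alg R) : ∀ v ∈ N, ⁅y, v⁆ ∈ N := by
  -- The stabilizer of `N` is a Lie subalgebra containing the generators, so the projection from the
  -- free Lie algebra factors through it.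
  let S : LieSubalgebra k (Alg R) :=
    { carrier := {y | ∀ v ∈ N, ⁅y, v⁆ ∈ N}
      add_mem' := fun ha hb v hv => by rw [add_lie]; exact N.add_mem (ha v hv) (hb v hv)
      zero_mem' := fun v _ => by simp
      smul_mem' := fun c a ha v hv => by rw [smul_lie]; exact N.smul_mem _ (ha v hv)
      lie_mem' := fun ha hb v hv => by
        rw [lie_lie]; exact N.sub_mem (ha _ (hb v hv)) (hb _ (ha v hv)) }
  let q : FreeLieAlgebra k (Gen I 𝔥) →ₗ⁅k⁆ Alg R :=
    { toFun := fun z => LieSubmodule.Quotient.mk (auxMk R z)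
      map_add' := fun _ _ => rfl
      map_smul' := fun _ _ => rfl
      map_lie' := rfl }
  let g : Gen I 𝔥 → S
    | .E i => ⟨R.e i, hE i⟩
    | .F i => ⟨R.f i, hF i⟩
    | .H x => ⟨R.h x, hH x⟩
  have hq : S.incl.comp (FreeLieAlgebra.lift k g) = q := by
    refine FreeLieAlgebra.hom_ext fun z => ?_
    rw [LieHom.comp_apply, FreeLieAlgebra.lift_of_apply]
    cases z <;> rfl
  obtain ⟨y, rfl⟩ := LieSubmodule.Quotient.surjective_mk' _ y
  obtain ⟨y, rfl⟩ := LieSubmodule.Quotient.surjective_mk' _ y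
  have : q y ∈ S := by
    rw [← hq]
    exact (FreeLieAlgebra.lift k g y).2
  exact this

/-- Every weight of an integrable lowest weight module lies in the cone spanned by the simple
roots at its lowest weight. -/
theorem sub_mem_cone_of_mem_wtSpace {lam : Module.Dual k 𝔥}
    (hV : IsIntegrableLowestWeight R V lam) {mu : Module.Dual k 𝔥} {v : V}
    (hv : v ∈ wtSpace R V mu) (h0 : v ≠ 0) : mu - lam ∈ R.cone := by
  obtain ⟨u, -, huH, huF, hu⟩ := hV.generated
  let W : List I → V := fun l => (l.map (R.opE V)).prod u
  have hW : ∀ i l, W (i :: l) = R.opE V i (W l) := fun i l => by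
    simp only [W, List.map_cons, List.prod_cons, Module.End.mul_apply]
  have hWt : ∀ l, W l ∈ wtSpace R V (lam + (l.map R.root).sum) := fun l => by
    induction l with
    | nil =>
      have h : u ∈ wtSpace R V lam := huH
      simpa [W] using h
    | cons i l ih =>
      rw [hW, List.map_cons, List.sum_cons, add_comm (R.root i), ← add_assoc]
      exact opE_mem_wtSpace ih i
  -- Words in the `e_i` applied to the lowest weight vector already span `V`: their span is stable
  -- under all the generators. No triangular decomposition of the algebra is needed.
  let N : Submodule k V := Submodule.span k (Set.range W)
  have hWN : ∀ l, W l ∈ N := fun l => Submodule.subset_span ⟨l, rfl⟩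
  have stable : ∀ T : Module.End k V, (∀ l, T (W l) ∈ N) → ∀ v ∈ N, T v ∈ N := by
    intro T hT v hv
    have : N ≤ N.comap T := Submodule.span_le.2 (by rintro _ ⟨l, rfl⟩; exact hT l)
    exact this hv
  have hE : ∀ i, ∀ v ∈ N, R.opE V i v ∈ N := fun i => stable _ fun l => by
    rw [← hW]; exact hWN _
  have hH : ∀ x, ∀ v ∈ N, R.opH V x v ∈ N := fun x => stable _ fun l => by
    rw [hWt l x]; exact N.smul_mem _ (hWN l)
  have hF : ∀ i, ∀ v ∈ N, R.opF V i v ∈ N := fun i => stable _ fun l => by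
    induction l with
    | nil =>
      have : R.opF V i (W []) = 0 := huF i
      rw [this]; exact N.zero_mem
    | cons j l ih =>
      rw [hW]
      by_cases hij : j = i
      · subst hij
        rw [← sub_eq_of_eq_add (opE_opF j (W l))]
        exact N.sub_mem (hE j _ ih) (hH _ _ (hWN l))
      · rw [← opE_opF_of_ne hij]
        exact hE j _ ih
  have hlie := lie_mem_of_stable N hE hF hH
  let N' : LieSubmodule k (Alg R) V := { N with lie_mem := hlie _ _ }
  have hN' : N' = ⊤ := top_unique (hu ▸ LieSubmodule.lieSpan_le.2 (by
    rintro _ rfl; exact hWN []))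
  by_contra hmu
  -- If `mu - lam` were outside the cone, no spanning word would have weight `mu`, so independence
  -- of the weight spaces would kill `v`.
  have hle : N ≤ ⨆ nu ≠ mu, wtSpace R V nu := Submodule.span_le.2 (by
    rintro _ ⟨l, rfl⟩
    refine Submodule.mem_iSup_of_mem (lam + (l.map R.root).sum) (Submodule.mem_iSup_of_mem ?_ (hWt l))
    rintro rfl
    apply hmu
    rw [add_sub_cancel_left]
    refine AddSubmonoid.list_sum_mem _ fun x hx => ?_
    obtain ⟨i, -, rfl⟩ := List.mem_map.1 hx
    exact root_mem_cone i)
  have hvN : v ∈ N' := hN' ▸ LieSubmodule.mem_top v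
  exact h0 (Submodule.disjoint_def.1 (iSupIndep_wtSpace mu) v hv (hle hvN))

/-- The weights of a module. -/
def IsWt (R : Realization k I 𝔥) (V : Type*) [AddCommGroup V] [Module k V]
    [LieRingModule (Alg R) V] [LieModule k (Alg R) V] (mu : Module.Dual k 𝔥) : Prop :=
  ∃ v ∈ wtSpace R V mu, v ≠ 0

theorem exists_int_of_mem_cone {mu : Module.Dual k 𝔥} (h : mu ∈ R.cone) (i : I) :
    ∃ z : ℤ, mu (R.coroot i) = z := by
  induction h using AddSubmonoid.closure_induction with
  | mem x hx => obtain ⟨j, rfl⟩ := hx; exact ⟨_, R.root_coroot i j⟩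
  | zero => exact ⟨0, by simp⟩
  | add x y _ _ hx hy =>
    obtain ⟨a, ha⟩ := hx
    obtain ⟨b, hb⟩ := hy
    exact ⟨a + b, by simp [ha, hb]⟩

theorem IsWt.exists_int {lam : Module.Dual k 𝔥} (hV : IsIntegrableLowestWeight R V lam)
    {i : I} (hl : ∃ z : ℤ, lam (R.coroot i) = z) {mu : Module.Dual k 𝔥} (h : IsWt R V mu) :
    ∃ z : ℤ, mu (R.coroot i) = z := by
  obtain ⟨v, hv, h0⟩ := h
  obtain ⟨a, ha⟩ := exists_int_of_mem_cone (sub_mem_cone_of_mem_wtSpace hV hv h0) i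
  obtain ⟨b, hb⟩ := hl
  exact ⟨a + b, by push_cast; rw [← ha, ← hb]; simp⟩

variable [CharZero k]

theorem pow_opF_ne_zero {lam : Module.Dual k 𝔥} (hV : IsIntegrableLowestWeight R V lam)
    {mu : Module.Dual k 𝔥} {v : V} (hv : v ∈ wtSpace R V mu) (h0 : v ≠ 0) {i : I} {m : ℕ}
    (hm : mu (R.coroot i) = m) : (R.opF V i ^ m) v ≠ 0 := fun h => by
  obtain ⟨r, hr⟩ := hV.e_nilpotent i v
  exact h0 ((sl2Ops R V i).eq_zero_of_pow_f_eq_zero (by rw [hv, hm]) le_rfl h hr)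

theorem pow_opE_ne_zero {lam : Module.Dual k 𝔥} (hV : IsIntegrableLowestWeight R V lam)
    {mu : Module.Dual k 𝔥} {v : V} (hv : v ∈ wtSpace R V mu) (h0 : v ≠ 0) {i : I} {m : ℕ}
    (hm : mu (R.coroot i) = -(m : k)) : (R.opE V i ^ m) v ≠ 0 := fun h => by
  obtain ⟨r, hr⟩ := hV.f_nilpotent i v
  exact h0 ((sl2Ops R V i).eq_zero_of_pow_e_eq_zero (by rw [hv, hm]) le_rfl h hr)

/-- The set of weights is stable under the simple reflections. -/
theorem IsWt.refl {lam : Module.Dual k 𝔥} (hV : IsIntegrableLowestWeight R V lam)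
    (hl : ∀ i, ∃ z : ℤ, lam (R.coroot i) = z) {mu : Module.Dual k 𝔥} (h : IsWt R V mu) (i : I) :
    IsWt R V (R.refl i mu) := by
  obtain ⟨z, hz⟩ := h.exists_int hV (hl i)
  obtain ⟨v, hv, h0⟩ := h
  obtain ⟨m, rfl | rfl⟩ := z.eq_nat_or_neg
  · refine ⟨_, ?_, pow_opF_ne_zero hV hv h0 (m := m) (by simpa using hz)⟩
    have := pow_opF_mem_wtSpace hv i m
    rwa [← Nat.cast_smul_eq_nsmul k, ← Int.cast_natCast, ← hz, ← refl_apply] at this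
  · refine ⟨_, ?_, pow_opE_ne_zero hV hv h0 (m := m) (by simpa using hz)⟩
    have := pow_opE_mem_wtSpace hv i m
    have h2 : (m : k) = -mu (R.coroot i) := by rw [hz]; simp
    rwa [← Nat.cast_smul_eq_nsmul k, h2, neg_smul, ← sub_eq_add_neg, ← refl_apply] at this

theorem IsWt.list_refl {lam : Module.Dual k 𝔥} (hV : IsIntegrableLowestWeight R V lam)
    (hl : ∀ i, ∃ z : ℤ, lam (R.coroot i) = z) {mu : Module.Dual k 𝔥} (h : IsWt R V mu)
    (l : List I) : IsWt R V ((l.map R.refl).prod mu) := by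
  induction l with
  | nil => simpa using h
  | cons i l ih => simpa using ih.refl hV hl i

end Weights

/-! ### Reduced words and positive roots. -/

section RootPositivity

variable {k I 𝔥 : Type*} [Field k] [AddCommGroup 𝔥] [Module k 𝔥] (R : Realization k I 𝔥)

namespace Realization

/-- `g` is a product of `n` simple reflections. -/
def IsWord (n : ℕ) (g : Module.End k (Module.Dual k 𝔥)) : Prop :=
  ∃ l : List I, l.length = n ∧ (l.map R.refl).prod = g

variable {R} in
theorem IsWord.mul {m n : ℕ} {g g' : Module.End k (Module.Dual k 𝔥)} (h : R.IsWord m g)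
    (h' : R.IsWord n g') : R.IsWord (m + n) (g * g') := by
  obtain ⟨l, rfl, rfl⟩ := h
  obtain ⟨l', rfl, rfl⟩ := h'
  exact ⟨l ++ l', by simp, by simp⟩

theorem isWord_refl (i : I) : R.IsWord 1 (R.refl i) := ⟨[i], rfl, by simp⟩

theorem isWord_one : R.IsWord 0 1 := ⟨[], rfl, rfl⟩

/-- The alternating product `⋯ s_t s_s s_t` of `n` simple reflections. -/
def alt : I → I → ℕ → Module.End k (Module.Dual k 𝔥)
  | _, _, 0 => 1
  | s, t, n + 1 => alt t s n * R.refl t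

/-- The letter by which `alt s t n` is extended on the left. -/
def altHead : I → I → ℕ → I
  | _, t, 0 => t
  | s, t, n + 1 => altHead t s n

theorem alt_succ' (s t : I) (n : ℕ) :
    R.alt s t (n + 1) = R.refl (altHead s t n) * R.alt s t n := by
  induction n generalizing s t with
  | zero => simp [alt, altHead]
  | succ n ih => rw [alt, ih, mul_assoc]; rfl

theorem altHead_cases (s t : I) (n : ℕ) :
    (altHead s t n = t ∧ altHead s t (n + 1) = s) ∨
      (altHead s t n = s ∧ altHead s t (n + 1) = t) := by
  induction n generalizing s t with
  | zero => exact Or.inl ⟨rfl, rfl⟩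
  | succ n ih => exact (ih t s).symm

theorem isWord_alt (s t : I) (n : ℕ) : R.IsWord n (R.alt s t n) := by
  induction n generalizing s t with
  | zero => exact R.isWord_one
  | succ n ih => exact (ih t s).mul (R.isWord_refl t)

theorem exists_alt_add (s t : I) (d m : ℕ) :
    ∃ g, R.IsWord d g ∧ R.alt s t (d + m) = g * R.alt s t m := by
  induction d with
  | zero => exact ⟨1, R.isWord_one, by simp⟩
  | succ d ih =>
    obtain ⟨g, hg, h⟩ := ih
    refine ⟨R.refl (altHead s t (d + m)) * g, ?_, ?_⟩
    · rw [add_comm]; exact (R.isWord_refl _).mul hg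
    · rw [mul_assoc, ← h, ← alt_succ']; congr 1; omega

theorem refl_root_self (i : I) : R.refl i (R.root i) = -R.root i := by
  rw [refl_apply, root_coroot_self]; module

/-- The inequality `2q ≤ bp` is an invariant: `s_t` turns `(p, q)` into `(p, bp - q)`, and after
exchanging the roles of `s` and `t` the required `2p ≤ a(bp - q)` follows from `ab ≥ 4`. -/
theorem alt_root_mem_of_four_le {a b : ℕ} {s t : I} (ha : R.cartan s t = -a)
    (hb : R.cartan t s = -b) (hab : 4 ≤ a * b) (n : ℕ) {p q : ℤ} (hq : 0 ≤ q)
    (hp : 2 * q ≤ b * p) (hp0 : 0 ≤ p) :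
    ∃ x y : ℕ, R.alt s t n (p • R.root s + q • R.root t) = x • R.root s + y • R.root t := by
  induction n generalizing s t a b p q with
  | zero =>
    lift p to ℕ using hp0
    lift q to ℕ using hq
    exact ⟨p, q, by simp [alt]⟩
  | succ n ih =>
    have hq' : 0 ≤ b * p - q := by nlinarith
    obtain ⟨x, y, h⟩ := ih (s := t) (t := s) (a := b) (b := a) hb ha (by rwa [mul_comm])
      (p := b * p - q) (q := p) hp0 (by
        have : (4 : ℤ) * p ≤ a * b * p := mul_le_mul_of_nonneg_right (by exact_mod_cast hab) hp0
        have h2 : (a : ℤ) * (2 * q) ≤ a * (b * p) := mul_le_mul_of_nonneg_left hp (by positivity)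
        nlinarith) hq'
    refine ⟨y, x, ?_⟩
    rw [add_comm (y • _), ← h, alt, Module.End.mul_apply]
    congr 1
    rw [map_add, map_zsmul, map_zsmul, refl_root_self, refl_apply, root_coroot, hb]
    push_cast
    module

theorem refl_add_left {a : ℕ} {s t : I} (ha : R.cartan s t = -a) (mu : Module.Dual k 𝔥)
    (p q : k) : R.refl s (mu + p • R.root s + q • R.root t) =
      mu + (a * q - p - mu (R.coroot s)) • R.root s + q • R.root t := by
  simp only [refl_apply, LinearMap.add_apply, LinearMap.smul_apply, root_coroot_self, root_coroot,
    ha, smul_eq_mul]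
  push_cast
  module

theorem refl_add_right {b : ℕ} {s t : I} (hb : R.cartan t s = -b) (mu : Module.Dual k 𝔥)
    (p q : k) : R.refl t (mu + p • R.root s + q • R.root t) =
      mu + p • R.root s + (b * p - q - mu (R.coroot t)) • R.root t := by
  rw [add_right_comm, R.refl_add_left hb, add_right_comm]

set_option linter.unusedSimpArgs false in
/-- In rank two, an alternating product sends the other simple root to a positive combination of
the two simple roots, unless it is long enough for a braid relation. -/
theorem alt_root_mem_or_braid {s t : I} (hst : s ≠ t) (n : ℕ) :
    (∃ x y : ℕ, R.alt s t n (R.root s) = x • R.root s + y • R.root t) ∨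
      ∃ m < n, R.alt s t (m + 1) = R.alt t s (m + 1) := by
  obtain ⟨a, ha⟩ : ∃ a : ℕ, R.cartan s t = -a :=
    ⟨(-R.cartan s t).toNat, by have := R.cartan_nonpos s t hst; omega⟩
  obtain ⟨b, hb⟩ : ∃ b : ℕ, R.cartan t s = -b :=
    ⟨(-R.cartan t s).toNat, by have := R.cartan_nonpos t s hst.symm; omega⟩
  by_cases hab : 4 ≤ a * b
  · left
    simpa using R.alt_root_mem_of_four_le ha hb hab n (p := 1) (q := 0) le_rfl (by simp) (by simp)
  -- The zero multiples put every vector in the shape on which `refl_add_left` and `refl_add_right`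
  -- rewrite.
  have braid : ∀ m, (∀ mu, R.alt s t (m + 1) (mu + (0 : k) • R.root s + (0 : k) • R.root t) =
      R.alt t s (m + 1) (mu + (0 : k) • R.root s + (0 : k) • R.root t)) → m < n →
      ∃ m < n, R.alt s t (m + 1) = R.alt t s (m + 1) := fun m h hm =>
    ⟨m, hm, LinearMap.ext fun mu => by simpa using h mu⟩
  have posi : ∀ (x y : ℕ), R.alt s t n (0 + (1 : k) • R.root s + (0 : k) • R.root t) =
      0 + (x : k) • R.root s + (y : k) • R.root t →
      ∃ x y : ℕ, R.alt s t n (R.root s) = x • R.root s + y • R.root t := fun x y h =>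
    ⟨x, y, by simpa [Nat.cast_smul_eq_nsmul] using h⟩
  have hz1 : a = 0 → b = 0 := fun h => by
    have := R.cartan_zero s t (by omega); omega
  have hz2 : b = 0 → a = 0 := fun h => by
    have := R.cartan_zero t s (by omega); omega
  have ha3 : a ≤ 3 := by
    by_contra h
    have : 1 ≤ b := by by_contra h'; have := hz2 (by omega); omega
    nlinarith
  have hb3 : b ≤ 3 := by
    by_contra h
    have : 1 ≤ a := by by_contra h'; have := hz1 (by omega); omega
    nlinarith
  have key : (a = 0 ∧ b = 0) ∨ (a = 1 ∧ b = 1) ∨ (a = 1 ∧ b = 2) ∨ (a = 2 ∧ b = 1) ∨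
      (a = 1 ∧ b = 3) ∨ (a = 3 ∧ b = 1) := by
    clear braid posi
    interval_cases a <;> interval_cases b <;> simp_all
  have hL := R.refl_add_left ha
  have hR := R.refl_add_right hb
  -- The finite types `A₁ × A₁`, `A₂`, `B₂` (twice) and `G₂` (twice), with braid relations of length
  -- 2, 3, 4 and 6; the shorter products are listed explicitly.
  rcases key with ⟨rfl, rfl⟩ | ⟨rfl, rfl⟩ | ⟨rfl, rfl⟩ | ⟨rfl, rfl⟩ | ⟨rfl, rfl⟩ | ⟨rfl, rfl⟩
  · by_cases hn : 1 < n
    · exact Or.inr (braid 1 (fun mu => by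
        simp only [alt, one_mul, Module.End.mul_apply, hL, hR]; push_cast; module) hn)
    · left
      obtain rfl | rfl : n = 0 ∨ n = 1 := by omega
      · exact posi 1 0 (by simp [alt])
      · exact posi 1 0 (by simp only [alt, one_mul, Module.End.mul_apply, hL, hR]; simp)
  · by_cases hn : 2 < n
    · exact Or.inr (braid 2 (fun mu => by
        simp only [alt, one_mul, Module.End.mul_apply, hL, hR]; push_cast; module) hn)
    · left
      obtain rfl | rfl | rfl : n = 0 ∨ n = 1 ∨ n = 2 := by omega
      · exact posi 1 0 (by simp [alt])
      · exact posi 1 1 (by simp only [alt, one_mul, Module.End.mul_apply, hL, hR]; simp)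
      · exact posi 0 1 (by simp only [alt, one_mul, Module.End.mul_apply, hL, hR]; simp)
  · by_cases hn : 3 < n
    · exact Or.inr (braid 3 (fun mu => by
        simp only [alt, one_mul, Module.End.mul_apply, hL, hR]; push_cast; module) hn)
    · left
      obtain rfl | rfl | rfl | rfl : n = 0 ∨ n = 1 ∨ n = 2 ∨ n = 3 := by omega
      · exact posi 1 0 (by simp [alt])
      · exact posi 1 2 (by simp only [alt, one_mul, Module.End.mul_apply, hL, hR]; simp)
      · exact posi 1 2 (by simp only [alt, one_mul, Module.End.mul_apply, hL, hR]; simp; module)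
      · exact posi 1 0 (by simp only [alt, one_mul, Module.End.mul_apply, hL, hR]; simp; module)
  · by_cases hn : 3 < n
    · exact Or.inr (braid 3 (fun mu => by
        simp only [alt, one_mul, Module.End.mul_apply, hL, hR]; push_cast; module) hn)
    · left
      obtain rfl | rfl | rfl | rfl : n = 0 ∨ n = 1 ∨ n = 2 ∨ n = 3 := by omega
      · exact posi 1 0 (by simp [alt])
      · exact posi 1 1 (by simp only [alt, one_mul, Module.End.mul_apply, hL, hR]; simp)
      · exact posi 1 1 (by simp only [alt, one_mul, Module.End.mul_apply, hL, hR]; simp; module)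
      · exact posi 1 0 (by simp only [alt, one_mul, Module.End.mul_apply, hL, hR]; simp; module)
  · by_cases hn : 5 < n
    · exact Or.inr (braid 5 (fun mu => by
        simp only [alt, one_mul, Module.End.mul_apply, hL, hR]; push_cast; module) hn)
    · left
      obtain rfl | rfl | rfl | rfl | rfl | rfl : n = 0 ∨ n = 1 ∨ n = 2 ∨ n = 3 ∨ n = 4 ∨ n = 5 := by omega
      · exact posi 1 0 (by simp [alt])
      · exact posi 1 3 (by simp only [alt, one_mul, Module.End.mul_apply, hL, hR]; simp)
      · exact posi 2 3 (by simp only [alt, one_mul, Module.End.mul_apply, hL, hR]; simp; module)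
      · exact posi 2 3 (by simp only [alt, one_mul, Module.End.mul_apply, hL, hR]; simp; module)
      · exact posi 1 3 (by simp only [alt, one_mul, Module.End.mul_apply, hL, hR]; simp; module)
      · exact posi 1 0 (by simp only [alt, one_mul, Module.End.mul_apply, hL, hR]; simp; module)
  · by_cases hn : 5 < n
    · exact Or.inr (braid 5 (fun mu => by
        simp only [alt, one_mul, Module.End.mul_apply, hL, hR]; push_cast; module) hn)
    · left
      obtain rfl | rfl | rfl | rfl | rfl | rfl : n = 0 ∨ n = 1 ∨ n = 2 ∨ n = 3 ∨ n = 4 ∨ n = 5 := by omega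
      · exact posi 1 0 (by simp [alt])
      · exact posi 1 1 (by simp only [alt, one_mul, Module.End.mul_apply, hL, hR]; simp)
      · exact posi 2 1 (by simp only [alt, one_mul, Module.End.mul_apply, hL, hR]; simp; module)
      · exact posi 2 1 (by simp only [alt, one_mul, Module.End.mul_apply, hL, hR]; simp; module)
      · exact posi 1 1 (by simp only [alt, one_mul, Module.End.mul_apply, hL, hR]; simp; module)
      · exact posi 1 0 (by simp only [alt, one_mul, Module.End.mul_apply, hL, hR]; simp; module)

/-- If `g` is a product of `n` simple reflections, and neither `g` nor `g s_s` is a product of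
fewer, then `g` sends the simple root `α_s` to a positive root. -/
theorem apply_root_mem_cone {n : ℕ} {g : Module.End k (Module.Dual k 𝔥)} (hg : R.IsWord n g)
    (hred : ∀ m < n, ¬ R.IsWord m g) {s : I} (hs : ∀ m < n, ¬ R.IsWord m (g * R.refl s)) :
    g (R.root s) ∈ R.cone := by
  induction n using Nat.strong_induction_on generalizing g s with
  | _ n ih =>
  rcases n with _ | n
  · obtain ⟨l, hl, rfl⟩ := hg
    rw [List.length_eq_zero_iff.1 hl]
    simpa using R.root_mem_cone s
  obtain ⟨l, hl, hlg⟩ := hg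
  obtain ⟨l, t, rfl⟩ : ∃ l' t, l = l' ++ [t] :=
    ⟨l.dropLast, l.getLast (by rintro rfl; simp at hl), (List.dropLast_append_getLast _).symm⟩
  have hln : R.IsWord n (l.map R.refl).prod := ⟨l, by simpa using hl, rfl⟩
  simp only [List.map_append, List.map_cons, List.map_nil, List.prod_append, List.prod_cons,
    List.prod_nil, mul_one] at hlg
  have hst : s ≠ t := by
    rintro rfl
    refine hs n (by omega) ?_
    rwa [← hlg, mul_assoc, refl_mul_refl, mul_one]
  let Q : ℕ → Prop := fun N => ∃ v c, R.IsWord c v ∧ c + N = n + 1 ∧ v * R.alt s t N = g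
  -- Choose a factorization `g = v * alt` whose alternating tail cannot be extended without losing
  -- reducedness. Then neither `v s_s` nor `v s_t` is shorter than `v`, so by induction `v` sends
  -- both simple roots into the cone.
  obtain ⟨N, ⟨v, c, hv, hc, hvg⟩, hN⟩ : ∃ N, Q (N + 1) ∧ ¬ Q (N + 2) := by
    by_contra! h
    have hQ : ∀ N, Q (N + 1) := fun N => by
      induction N with
      | zero => exact ⟨_, n, hln, rfl, by simpa [alt] using hlg⟩
      | succ N ih => exact h N ih
    obtain ⟨_, c, _, h, _⟩ := hQ (n + 1)
    omega
  have hvred : ∀ m < c, ¬ R.IsWord m v := fun m hm h =>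
    hred _ (by omega) (hvg ▸ h.mul (R.isWord_alt s t (N + 1)))
  have h1 : v (R.root (altHead s t N)) ∈ R.cone := by
    refine ih c (by omega) hv hvred fun m hm h => hred (m + N) (by omega) ?_
    have := h.mul (R.isWord_alt s t N)
    rwa [mul_assoc, ← alt_succ', hvg] at this
  have h2 : v (R.root (altHead s t (N + 1))) ∈ R.cone := by
    refine ih c (by omega) hv hvred fun m hm h => ?_
    have h3 : v * R.refl (altHead s t (N + 1)) * R.alt s t (N + 2) = g := by
      rw [alt_succ', mul_assoc, ← mul_assoc (R.refl _), refl_mul_refl, one_mul, hvg]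
    have h4 := h.mul (R.isWord_alt s t (N + 2))
    rw [h3] at h4
    by_cases hm' : m + (N + 2) < n + 1
    · exact hred _ hm' h4
    · exact hN ⟨_, m, h, by omega, h3⟩
  have h12 : v (R.root s) ∈ R.cone ∧ v (R.root t) ∈ R.cone := by
    obtain ⟨e1, e2⟩ | ⟨e1, e2⟩ := altHead_cases s t N <;> rw [e1] at h1 <;> rw [e2] at h2
    exacts [⟨h2, h1⟩, ⟨h1, h2⟩]
  obtain ⟨x, y, h⟩ | ⟨m, hm, h⟩ := R.alt_root_mem_or_braid hst (N + 1)
  · rw [← hvg, Module.End.mul_apply, h, map_add, map_nsmul, map_nsmul]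
    exact add_mem (nsmul_mem h12.1 x) (nsmul_mem h12.2 y)
  -- A braid relation rewrites the tail so that `s` comes last, and `g s_s` then has a word of
  -- length `n`.
  · exfalso
    obtain ⟨d, hd⟩ : ∃ d, N + 1 = d + (m + 1) := ⟨N - m, by omega⟩
    obtain ⟨g', hg', hg2⟩ := R.exists_alt_add s t d (m + 1)
    refine hs (c + d + m) (by omega) ?_
    have h5 : g * R.refl s = v * g' * R.alt s t m := by
      rw [← hvg, hd, hg2, h, alt, mul_assoc, mul_assoc, mul_assoc, refl_mul_refl, mul_one, mul_assoc]
    rw [h5]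
    exact (hv.mul hg').mul (R.isWord_alt s t m)

end Realization

end RootPositivity

/-! ### Extremal weights along a reduced sequence, and the lower bound they give. -/

section Extremal

variable {k I 𝔥 : Type*} [Field k] [AddCommGroup 𝔥] [Module k 𝔥] {R : Realization k I 𝔥}

open Realization

theorem exists_finsupp_of_mem_cone {x : Module.Dual k 𝔥} (hx : x ∈ R.cone) :
    ∃ c : I →₀ k, Finsupp.linearCombination k R.root c = x ∧ ∀ i, ∃ n : ℕ, c i = n := by
  induction hx using AddSubmonoid.closure_induction with
  | mem x hx =>
    obtain ⟨i, rfl⟩ := hx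
    refine ⟨Finsupp.single i 1, by simp, fun j => ?_⟩
    by_cases h : i = j
    · exact ⟨1, by simp [h]⟩
    · exact ⟨0, by simp [h]⟩
  | zero => exact ⟨0, by simp, fun i => ⟨0, by simp⟩⟩
  | add x y _ _ hx hy =>
    obtain ⟨c, hc, hc'⟩ := hx
    obtain ⟨d, hd, hd'⟩ := hy
    refine ⟨c + d, by simp [hc, hd], fun i => ?_⟩
    obtain ⟨m, hm⟩ := hc' i
    obtain ⟨n, hn⟩ := hd' i
    exact ⟨m + n, by simp [hm, hn]⟩

theorem coeff_of_mem_cone {c : I →₀ k} (h : Finsupp.linearCombination k R.root c ∈ R.cone) (i : I) :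
    ∃ n : ℕ, c i = n := by
  obtain ⟨d, hd, hd'⟩ := exists_finsupp_of_mem_cone h
  rw [← R.root_indep hd]
  exact hd' i

variable {V : Type*} [AddCommGroup V] [Module k V] [LieRingModule (Alg R) V]
  [LieModule k (Alg R) V]

theorem IsWt.eq_zero {mu : Module.Dual k 𝔥} (h : ¬ IsWt R V mu) {v : V} (hv : v ∈ wtSpace R V mu) :
    v = 0 := by
  by_contra h0
  exact h ⟨v, hv, h0⟩

/-- `ν` is the weight of a nonzero vector obtained from `x` by applying operators `f_i`. -/
def Lowers (R : Realization k I 𝔥) {V : Type*} [AddCommGroup V] [Module k V]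
    [LieRingModule (Alg R) V] [LieModule k (Alg R) V] (nu : Module.Dual k 𝔥) (x : V) : Prop :=
  ∃ l : List I, (l.map (R.opF V)).prod x ≠ 0 ∧ (l.map (R.opF V)).prod x ∈ wtSpace R V nu

theorem list_opF_mem_wtSpace {mu : Module.Dual k 𝔥} {x : V} (hx : x ∈ wtSpace R V mu)
    (l : List I) : (l.map (R.opF V)).prod x ∈ wtSpace R V (mu - (l.map R.root).sum) := by
  induction l with
  | nil => simpa using hx
  | cons i l ih =>
    rw [List.map_cons, List.map_cons, List.prod_cons, Module.End.mul_apply, List.sum_cons,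
      add_comm, ← sub_sub]
    exact opF_mem_wtSpace ih i

theorem Lowers.sub_mem_cone {mu nu : Module.Dual k 𝔥} {x : V} (hx : x ∈ wtSpace R V mu)
    (h : Lowers R nu x) : mu - nu ∈ R.cone := by
  obtain ⟨l, h0, hl⟩ := h
  rw [← wt_unique h0 (list_opF_mem_wtSpace hx l) hl, sub_sub_cancel]
  refine AddSubmonoid.list_sum_mem _ fun y hy => ?_
  obtain ⟨i, -, rfl⟩ := List.mem_map.1 hy
  exact R.root_mem_cone i

theorem Lowers.of_pow_opF {nu : Module.Dual k 𝔥} {x : V} {i : I} {m : ℕ} {l : List I}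
    (h0 : (R.opF V i ^ m) ((l.map (R.opF V)).prod x) ≠ 0)
    (h : (R.opF V i ^ m) ((l.map (R.opF V)).prod x) ∈ wtSpace R V nu) : Lowers R nu x :=
  ⟨List.replicate m i ++ l, by simpa using h0, by simpa using h⟩

/-- Moving `e_i` to the left past a letter `f_i` costs an element of `𝔥`, which acts by a scalar,
and deletes that letter; other letters commute with `e_i`. -/
theorem list_opF_opE_sub_mem_span {mu : Module.Dual k 𝔥} {x : V} (hx : x ∈ wtSpace R V mu)
    (i : I) (l : List I) :
    (l.map (R.opF V)).prod (R.opE V i x) - R.opE V i ((l.map (R.opF V)).prod x) ∈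
      Submodule.span k {y | ∃ l' : List I, (l'.map R.root).sum + R.root i = (l.map R.root).sum ∧
        y = (l'.map (R.opF V)).prod x} := by
  induction l with
  | nil => simp
  | cons j l ih =>
    simp only [List.map_cons, List.prod_cons, List.sum_cons, Module.End.mul_apply]
    set z := (l.map (R.opF V)).prod x with hz
    set S := {y | ∃ l' : List I, (l'.map R.root).sum + R.root i =
      R.root j + (l.map R.root).sum ∧ y = (l'.map (R.opF V)).prod x} with hS
    have h1 : R.opF V j ((l.map (R.opF V)).prod (R.opE V i x) - R.opE V i z) ∈
        Submodule.span k S := by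
      refine (Submodule.span_le.2 ?_ :
        _ ≤ (Submodule.span k S).comap (R.opF V j)) ih
      rintro _ ⟨l', hl', rfl⟩
      exact Submodule.subset_span ⟨j :: l', by simp [← hl', add_assoc], by simp⟩
    have h2 : R.opF V j (R.opE V i z) - R.opE V i (R.opF V j z) ∈ Submodule.span k S := by
      by_cases hij : i = j
      · subst hij
        rw [opE_opF, sub_add_cancel_left, list_opF_mem_wtSpace hx l]
        exact Submodule.neg_mem _ (Submodule.smul_mem _ _
          (Submodule.subset_span ⟨l, add_comm _ _, rfl⟩))
      · rw [opE_opF_of_ne hij, sub_self]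
        exact Submodule.zero_mem _
    have h3 := Submodule.add_mem _ h1 h2
    rwa [map_sub, sub_add_sub_cancel] at h3

/-- The full word applied to `x` itself would have weight `nu - α_i`, hence vanishes. The nonzero
vector is thus a combination of shorter words applied to `x`, one of which must survive. -/
theorem Lowers.of_opE {mu nu : Module.Dual k 𝔥} {x : V} (hx : x ∈ wtSpace R V mu) {i : I}
    (hnu : ¬ IsWt R V (nu - R.root i)) (h : Lowers R nu (R.opE V i x)) : Lowers R nu x := by
  obtain ⟨l, h0, hl⟩ := h
  have hw : mu + R.root i - (l.map R.root).sum = nu :=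
    wt_unique h0 (list_opF_mem_wtSpace (opE_mem_wtSpace hx i) l) hl
  have h1 := list_opF_opE_sub_mem_span hx i l
  have h2 : (l.map (R.opF V)).prod x = 0 := by
    refine IsWt.eq_zero hnu ?_
    rw [← hw, sub_right_comm, add_sub_cancel_right]
    exact list_opF_mem_wtSpace hx l
  rw [h2, map_zero, sub_zero] at h1
  by_contra hc
  refine h0 ((Submodule.mem_bot k).1 ((Submodule.span_le.2 ?_ : _ ≤ (⊥ : Submodule k V)) h1))
  rintro _ ⟨l', hl', rfl⟩
  by_contra hne
  refine hc ⟨l', hne, ?_⟩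
  have h3 := list_opF_mem_wtSpace hx l'
  rwa [← hw, ← hl', add_sub_add_right_eq_sub]

theorem Lowers.of_pow_opE {mu nu : Module.Dual k 𝔥} {x : V} (hx : x ∈ wtSpace R V mu) {i : I}
    (hnu : ¬ IsWt R V (nu - R.root i)) (n : ℕ) (h : Lowers R nu ((R.opE V i ^ n) x)) :
    Lowers R nu x := by
  induction n with
  | zero => simpa using h
  | succ n ih =>
    rw [pow_succ', Module.End.mul_apply] at h
    exact ih (h.of_opE (pow_opE_mem_wtSpace hx i n) hnu)

variable (R) in
theorem list_refl_reverse_mul (l : List I) :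
    (l.reverse.map R.refl).prod * (l.map R.refl).prod = 1 := by
  induction l with
  | nil => simp
  | cons i l ih =>
    simp only [List.reverse_cons, List.map_append, List.map_cons, List.map_nil, List.prod_append,
      List.prod_cons, List.prod_nil, mul_one]
    rw [mul_assoc, ← mul_assoc (R.refl i), refl_mul_refl, one_mul, ih]

namespace ReducedSeq

variable (J : ReducedSeq R)

/-- The first `j` letters of the sequence. -/
def initial (j : ℕ) : List I := (List.range j).map J.letter

theorem initial_succ (j : ℕ) : J.initial (j + 1) = J.initial j ++ [J.letter j] := by
  simp [initial, List.range_succ]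

theorem initial_mul_weyl (j : ℕ) :
    ((J.initial j).map R.refl).prod * R.weyl J.letter j = 1 := by
  induction j with
  | zero => simp [initial, Realization.weyl]
  | succ j ih =>
    rw [initial_succ, Realization.weyl]
    simp only [List.map_append, List.map_cons, List.map_nil, List.prod_append, List.prod_cons,
      List.prod_nil, mul_one]
    rw [mul_assoc, ← mul_assoc (R.refl _), refl_mul_refl, one_mul, ih]

theorem weyl_eq_reverse (j : ℕ) :
    R.weyl J.letter j = ((J.initial j).reverse.map R.refl).prod := by
  have h := congrArg (((J.initial j).reverse.map R.refl).prod * ·) (J.initial_mul_weyl j)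
  rwa [← mul_assoc, list_refl_reverse_mul, one_mul, mul_one] at h

variable {J}

theorem not_isWord_initial {j : ℕ} (hj : (j : ℕ∞) ≤ J.length) {m : ℕ} (hm : m < j) :
    ¬ R.IsWord m ((J.initial j).map R.refl).prod := by
  rintro ⟨l, rfl, hl⟩
  have h : (l.reverse.map R.refl).prod = R.weyl J.letter j := by
    calc (l.reverse.map R.refl).prod
        = (l.reverse.map R.refl).prod * (((J.initial j).map R.refl).prod * R.weyl J.letter j) := by
          rw [initial_mul_weyl, mul_one]
      _ = R.weyl J.letter j := by rw [← mul_assoc, ← hl, list_refl_reverse_mul, one_mul]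
  have := J.reduced j hj _ h
  simp at this
  omega

theorem succ_le_length {j : ℕ} (hj : (j : ℕ∞) < J.length) : ((j + 1 : ℕ) : ℕ∞) ≤ J.length := by
  push_cast
  exact Order.add_one_le_of_lt hj

theorem initial_root_mem_cone {j : ℕ} (hj : (j : ℕ∞) < J.length) :
    ((J.initial j).map R.refl).prod (R.root (J.letter j)) ∈ R.cone := by
  refine R.apply_root_mem_cone (n := j) ⟨_, by simp [initial], rfl⟩
    (fun m hm => not_isWord_initial hj.le hm) fun m hm => ?_
  have h := not_isWord_initial (succ_le_length hj) (m := m) (by omega)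
  rwa [initial_succ, List.map_append, List.prod_append, List.map_singleton,
    List.prod_singleton] at h

end ReducedSeq

variable [CharZero k]

theorem eq_zero_of_mem_cone {x : Module.Dual k 𝔥} (hx : x ∈ R.cone) (hx' : -x ∈ R.cone) :
    x = 0 := by
  obtain ⟨c, rfl, hc⟩ := exists_finsupp_of_mem_cone hx
  rw [← map_neg] at hx'
  suffices c = 0 by rw [this, map_zero]
  ext i
  obtain ⟨m, hm⟩ := hc i
  obtain ⟨n, hn⟩ := coeff_of_mem_cone hx' i
  rw [Finsupp.neg_apply, hm, neg_eq_iff_add_eq_zero] at hn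
  have : m + n = 0 := by exact_mod_cast hn
  rw [hm, show m = 0 by omega]
  simp

variable {t : I} {ϖ : Module.Dual k 𝔥}

theorem not_isWt_sub (hV : IsIntegrableLowestWeight R V (-ϖ)) {y : Module.Dual k 𝔥}
    (hy : y ∈ R.cone) (h0 : y ≠ 0) : ¬ IsWt R V (-ϖ - y) := by
  rintro ⟨v, hv, hv0⟩
  have h := sub_mem_cone_of_mem_wtSpace hV hv hv0
  rw [sub_sub_cancel_left] at h
  exact h0 (eq_zero_of_mem_cone hy h)

omit [CharZero k] in
theorem IsFundamentalWeight.exists_int (hϖ : IsFundamentalWeight R t ϖ) (i : I) :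
    ∃ z : ℤ, (-ϖ) (R.coroot i) = z := by
  refine ⟨if i = t then -1 else 0, ?_⟩
  rw [LinearMap.neg_apply, hϖ i]
  split_ifs <;> simp

omit [CharZero k] in
theorem isWt_lowest (hV : IsIntegrableLowestWeight R V (-ϖ)) : IsWt R V (-ϖ) := by
  obtain ⟨v, h0, hv, -, -⟩ := hV.generated
  exact ⟨v, hv, h0⟩

variable (hV : IsIntegrableLowestWeight R V (-ϖ)) (hϖ : IsFundamentalWeight R t ϖ)
  {J : ReducedSeq R}

include hV hϖ

theorem isWt_weyl (j : ℕ) : IsWt R V (-(R.weyl J.letter j ϖ)) := by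
  have h := (isWt_lowest hV).list_refl hV hϖ.exists_int (J.initial j).reverse
  rwa [← J.weyl_eq_reverse, map_neg] at h

/-- Applying `w_j⁻¹` moves this weight to `-ϖ` minus a nonzero element of the cone, which is below
the lowest weight. -/
theorem not_isWt_weyl_sub {j : ℕ} (hj : (j : ℕ∞) < J.length) {c : ℕ} (hc : c ≠ 0) :
    ¬ IsWt R V (-(R.weyl J.letter j ϖ) - c • R.root (J.letter j)) := by
  intro h
  have h1 := h.list_refl hV hϖ.exists_int (J.initial j)
  rw [map_sub, map_neg, ← Module.End.mul_apply, J.initial_mul_weyl, Module.End.one_apply] at h1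
  refine not_isWt_sub hV ?_ ?_ h1
  · rw [map_nsmul]
    exact nsmul_mem (ReducedSeq.initial_root_mem_cone hj) c
  · intro h2
    have h3 := congrArg ((J.initial j).reverse.map R.refl).prod h2
    rw [← Module.End.mul_apply, list_refl_reverse_mul, Module.End.one_apply, map_zero,
      ← Nat.cast_smul_eq_nsmul k] at h3
    exact R.root_indep.ne_zero _ ((smul_eq_zero.1 h3).resolve_left (by exact_mod_cast hc))

theorem exists_weyl_coroot {j : ℕ} (hj : (j : ℕ∞) < J.length) :
    ∃ m : ℕ, (-(R.weyl J.letter j ϖ)) (R.coroot (J.letter j)) = -(m : k) := by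
  obtain ⟨v, hv, h0⟩ := isWt_weyl hV hϖ (J := J) j
  have h1 : R.opF V (J.letter j) v = 0 := by
    refine IsWt.eq_zero (not_isWt_weyl_sub hV hϖ hj one_ne_zero) ?_
    rw [one_smul]
    exact opF_mem_wtSpace hv _
  obtain ⟨r, hr⟩ := hV.e_nilpotent (J.letter j) v
  obtain ⟨m, hm⟩ := (sl2Ops R V (J.letter j)).swap.exists_nat_of_e_eq_zero
    (w := -(-(R.weyl J.letter j ϖ)) (R.coroot (J.letter j)))
    (by rw [LinearMap.neg_apply, hv, neg_smul]) h0 h1 hr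
  exact ⟨m, by rw [← hm, neg_neg]⟩

/-- A sequence of vectors ending in an extremal weight has weights bounded below by the extremal
weights. -/
theorem sub_weyl_mem_cone {vec : ℕ → V} {wt : ℕ → Module.Dual k 𝔥} {q : ℕ}
    (hq : (q : ℕ∞) ≤ J.length) (hwt : ∀ j ≤ q, vec j ∈ wtSpace R V (wt j))
    (hstep : ∀ j < q, ∃ n : ℕ, (R.opE V (J.letter j) ^ n) (vec j) = vec (j + 1))
    (h0 : vec q ≠ 0) (hend : wt q = -(R.weyl J.letter q ϖ)) {j : ℕ} (hj : j ≤ q) :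
    wt j - -(R.weyl J.letter j ϖ) ∈ R.cone := by
  refine Lowers.sub_mem_cone (hwt j hj) ?_
  -- Going backwards, `f_i ^ m` brings a vector of weight `-w_{j+1} ϖ` to weight `-w_j ϖ`; the
  -- factor `e_i ^ n` can then be stripped because `-w_j ϖ - α_i` is not a weight.
  induction hj using Nat.decreasingInduction with
  | self => exact ⟨[], by simpa using h0, by simpa [← hend] using hwt q le_rfl⟩
  | of_succ j hj ih =>
    have hjl : (j : ℕ∞) < J.length := lt_of_lt_of_le (by exact_mod_cast hj) hq
    obtain ⟨n, hn⟩ := hstep j hj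
    obtain ⟨l, hl0, hl⟩ := ih
    obtain ⟨m, hm⟩ := exists_weyl_coroot hV hϖ hjl
    refine Lowers.of_pow_opE (hwt j hj.le) (i := J.letter j) ?_ n ?_
    · have := not_isWt_weyl_sub hV hϖ hjl one_ne_zero
      rwa [one_smul] at this
    have hw : -(R.weyl J.letter (j + 1) ϖ) = -(R.weyl J.letter j ϖ) + m • R.root (J.letter j) := by
      rw [Realization.weyl, Module.End.mul_apply, ← map_neg, refl_apply, hm]
      module
    rw [hn]
    refine Lowers.of_pow_opF (i := J.letter j) (m := m) (l := l) ?_ ?_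
    · refine pow_opF_ne_zero hV hl hl0 ?_
      rw [hw, LinearMap.add_apply, hm, LinearMap.smul_apply, root_coroot_self]
      simp; ring
    · have := pow_opF_mem_wtSpace hl (J.letter j) m
      rwa [hw, add_sub_cancel_right] at this

end Extremal

/-! ### Occurrences of a letter, and comparison with the driving trail. -/

section Driving

variable {k I 𝔥 : Type*} [Field k] [AddCommGroup 𝔥] [Module k 𝔥] {R : Realization k I 𝔥}

open Realization

namespace ReducedSeq

variable {J : ReducedSeq R} {s : I}

theorem pos_iff {m j : ℕ} : J.Pos s m j ↔ (j : ℕ∞) < J.length ∧ J.letter j = s ∧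
    Nat.count (fun i => J.letter i = s) j + 1 = m := by
  have : {i | i < j ∧ J.letter i = s} =
      ((Finset.range j).filter fun i => J.letter i = s : Finset ℕ) := by ext; simp
  rw [ReducedSeq.Pos, this, Set.ncard_coe_finset, Nat.count_eq_card_filter_range]

theorem Pos.lt_length {m j : ℕ} (h : J.Pos s m j) : (j : ℕ∞) < J.length := h.1

theorem Pos.letter_eq {m j : ℕ} (h : J.Pos s m j) : J.letter j = s := h.2.1

theorem Pos.one_le {m j : ℕ} (h : J.Pos s m j) : 1 ≤ m := by
  have := (pos_iff.1 h).2.2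
  omega

theorem Pos.unique {m j j' : ℕ} (h : J.Pos s m j) (h' : J.Pos s m j') : j = j' := by
  rw [pos_iff] at h h'
  have : Nat.count (fun i => J.letter i = s) j = Nat.count (fun i => J.letter i = s) j' := by
    omega
  exact Nat.count_injective (p := fun i => J.letter i = s) h.2.1 h'.2.1 this

theorem Pos.lt_of_lt {m m' j j' : ℕ} (h : J.Pos s m j) (h' : J.Pos s m' j') (hm : m < m') :
    j < j' := by
  rw [pos_iff] at h h'
  have : Nat.count (fun i => J.letter i = s) j < Nat.count (fun i => J.letter i = s) j' := by
    omega
  exact Nat.lt_of_count_lt_count this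

theorem exists_pos {j : ℕ} (hj : (j : ℕ∞) < J.length) (hs : J.letter j = s) :
    ∃ m, J.Pos s m j := ⟨_, pos_iff.2 ⟨hj, hs, rfl⟩⟩

theorem Pos.lt_of_index_lt {m m' j j' : ℕ} (h : J.Pos s m j) (h' : J.Pos s m' j') (hj : j < j') :
    m < m' := by
  by_contra hm
  obtain hm | rfl := (not_lt.1 hm).lt_or_eq
  · exact absurd (h'.lt_of_lt h hm) (by omega)
  · exact absurd (h.unique h') (by omega)

theorem Pos.exists_pred {m v : ℕ} (h : J.Pos s (m + 1) v) (hm : 1 ≤ m) :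
    ∃ u < v, J.Pos s m u := by
  have h2 := (pos_iff.1 h).2.2
  -- Occurrences are numbered from 1, while `Nat.nth` counts from 0.
  have hlt : m - 1 < Nat.count (fun i => J.letter i = s) v := by omega
  have h3 : Nat.nth (fun i => J.letter i = s) (m - 1) < v := Nat.nth_lt_of_lt_count hlt
  have h4 : ∀ hf : (Set.ofPred fun i => J.letter i = s).Finite, m - 1 < hf.toFinset.card :=
    fun hf => hlt.trans_le (Nat.count_le_card hf v)
  refine ⟨_, h3, pos_iff.2 ⟨lt_trans (by exact_mod_cast h3) h.lt_length, Nat.nth_mem _ h4, ?_⟩⟩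
  rw [Nat.count_nth h4]
  omega

theorem Pos.exists_le {n p : ℕ} (h : J.Pos s n p) {m : ℕ} (hm : 1 ≤ m) (hmn : m ≤ n) :
    ∃ u ≤ p, J.Pos s m u := by
  induction n generalizing p with
  | zero => omega
  | succ n ih =>
    obtain rfl | hlt := hmn.eq_or_lt
    · exact ⟨p, le_rfl, h⟩
    · obtain ⟨u, hu, hu'⟩ := h.exists_pred (by omega)
      obtain ⟨w, hw, hw'⟩ := ih hu' (by omega)
      exact ⟨w, by omega, hw'⟩

theorem Pos.letter_ne {m u v i : ℕ} (hu : J.Pos s m u) (hv : J.Pos s (m + 1) v) (h1 : u < i)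
    (h2 : i < v) : J.letter i ≠ s := by
  intro hi
  obtain ⟨l, hl⟩ := exists_pos (J := J) (j := i) (lt_trans (by exact_mod_cast h2) hv.lt_length) hi
  have := hu.lt_of_index_lt hl h1
  have := hl.lt_of_index_lt hv h2
  omega

theorem Pos.letter_ne_first {v i : ℕ} (hv : J.Pos s 1 v) (h2 : i < v) : J.letter i ≠ s := by
  intro hi
  obtain ⟨l, hl⟩ := exists_pos (J := J) (j := i) (lt_trans (by exact_mod_cast h2) hv.lt_length) hi
  have := hl.lt_of_index_lt hv h2
  have := hl.one_le
  omega

theorem face_eq {m u v : ℕ} (hu : J.Pos s m u) (hv : J.Pos s (m + 1) v) (j : ℕ) :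
    J.face s (m + 1) j = if u < j ∧ j ≤ v then R.root s else 0 := by
  rw [ReducedSeq.face]
  refine if_congr ⟨?_, fun h => ⟨v, u, m, hv, hu, rfl, h⟩⟩ rfl rfl
  rintro ⟨v', u', l, hv', hu', hl, h⟩
  obtain rfl : l = m := by omega
  rwa [hu.unique hu', hv.unique hv']

end ReducedSeq

variable {t : I} {ϖ : Module.Dual k 𝔥}

theorem refl_fundamental_of_ne (hϖ : IsFundamentalWeight R t ϖ) {i : I} (hi : i ≠ t) :
    R.refl i ϖ = ϖ := by
  rw [refl_apply, hϖ i, if_neg hi]; simp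

theorem refl_fundamental (hϖ : IsFundamentalWeight R t ϖ) : R.refl t ϖ = ϖ - R.root t := by
  rw [refl_apply, hϖ t, if_pos rfl]; simp

section

variable {J : ReducedSeq R}

theorem weyl_of_forall_ne (hϖ : IsFundamentalWeight R t ϖ) {j : ℕ}
    (h : ∀ i < j, J.letter i ≠ t) : R.weyl J.letter j ϖ = ϖ := by
  induction j with
  | zero => rfl
  | succ j ih =>
    rw [Realization.weyl, Module.End.mul_apply, ih fun i hi => h i (by omega),
      refl_fundamental_of_ne hϖ (h j (by omega))]

theorem driving_of_forall_ne {j : ℕ} (h : ∀ i, i + 1 < j → J.letter i ≠ t) :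
    J.driving t ϖ j = -(R.refl t ϖ) := by
  induction j with
  | zero => rfl
  | succ j ih =>
    rw [ReducedSeq.driving, if_neg, ih fun i hi => h i (by omega)]
    rintro ⟨i, hi, hi'⟩
    exact h i (by omega) hi'

theorem driving_of_exists (hϖ : IsFundamentalWeight R t ϖ) {j : ℕ}
    (h : ∃ i < j, J.letter i = t) : J.driving t ϖ j = -(R.weyl J.letter j ϖ) := by
  induction j with
  | zero => simp at h
  | succ j ih =>
    by_cases hj : ∃ i < j, J.letter i = t
    · rw [ReducedSeq.driving, if_pos hj, ih hj, Realization.weyl, Module.End.mul_apply, map_neg]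
    · have hj' : ∀ i < j, J.letter i ≠ t := fun i hi h => hj ⟨i, hi, h⟩
      have hjt : J.letter j = t := by
        obtain ⟨i, hi, hit⟩ := h
        obtain rfl | hi := (Nat.lt_succ_iff.1 hi).eq_or_lt
        · exact hit
        · exact absurd hit (hj' i hi)
      rw [driving_of_forall_ne fun i hi => hj' i (by omega), Realization.weyl,
        Module.End.mul_apply, weyl_of_forall_ne hϖ hj', hjt]

end

variable {V : Type*} [AddCommGroup V] [Module k V] [LieRingModule (Alg R) V]
  [LieModule k (Alg R) V] [CharZero k]
variable (hV : IsIntegrableLowestWeight R V (-ϖ)) (hϖ : IsFundamentalWeight R t ϖ)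
  {J : ReducedSeq R}

include hV hϖ

/-- The weights of a sequence of vectors which is eventually extremal are bounded below by those of
the driving trail. -/
theorem sub_driving_mem_cone {vec : ℕ → V} {wt : ℕ → Module.Dual k 𝔥} {p : ℕ}
    (hp : (p : ℕ∞) < J.length)
    (hvec : ∀ j : ℕ, (j : ℕ∞) ≤ J.length → vec j ≠ 0)
    (hwt : ∀ j : ℕ, (j : ℕ∞) ≤ J.length → vec j ∈ wtSpace R V (wt j))
    (hstep : ∀ j : ℕ, (j : ℕ∞) < J.length → ∃ n : ℕ, (R.opE V (J.letter j) ^ n) (vec j) = vec (j + 1))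
    (h0 : wt 0 = -(R.refl t ϖ))
    (hend : ∀ j : ℕ, p ≤ j → (j : ℕ∞) < J.length → wt (j + 1) = -(R.weyl J.letter (j + 1) ϖ))
    {j : ℕ} (hj : (j : ℕ∞) < J.length) : wt j - J.driving t ϖ j ∈ R.cone := by
  by_cases ht : ∃ i < j, J.letter i = t
  · rw [driving_of_exists hϖ ht]
    by_cases hjp : j ≤ p + 1
    · have hq := ReducedSeq.succ_le_length hp
      have hle : ∀ i, i ≤ p + 1 → (i : ℕ∞) ≤ J.length := fun i hi =>
        le_trans (by exact_mod_cast hi) hq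
      exact sub_weyl_mem_cone hV hϖ hq (fun i hi => hwt i (hle i hi))
        (fun i hi => hstep i (lt_of_le_of_lt (by exact_mod_cast Nat.lt_succ_iff.1 hi) hp))
        (hvec _ hq) (hend p le_rfl hp) hjp
    · obtain ⟨j, rfl⟩ : ∃ i, j = i + 1 := ⟨j - 1, by omega⟩
      rw [hend j (by omega) (lt_of_le_of_lt (by exact_mod_cast Nat.le_succ j) hj), sub_self]
      exact zero_mem _
  -- Before any step of letter `t` the driving weight is still the initial one, and each step only
  -- adds simple roots.
  · rw [driving_of_forall_ne fun i hi h => ht ⟨i, by omega, h⟩, ← h0]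
    clear ht
    induction j with
    | zero => rw [sub_self]; exact zero_mem _
    | succ j ih =>
      have hj' : (j : ℕ∞) < J.length := lt_of_le_of_lt (by exact_mod_cast Nat.le_succ j) hj
      obtain ⟨n, hn⟩ := hstep j hj'
      have hw : wt j + n • R.root (J.letter j) = wt (j + 1) :=
        wt_unique (hvec _ hj.le) (hn ▸ pow_opE_mem_wtSpace (hwt j hj'.le) _ n) (hwt _ hj.le)
      rw [← hw, add_sub_right_comm]
      exact add_mem (ih hj') (nsmul_mem (R.root_mem_cone _) n)

/-- The target weight is `-ϖ + α_t - α_s`, whose coefficient at `α_s` is negative. -/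
theorem opF_initial_eq_zero {s : I} (hst : s ≠ t) {v : V} (hv : v ∈ wtSpace R V (-(R.refl t ϖ))) :
    R.opF V s v = 0 := by
  by_contra h0
  have h1 := sub_mem_cone_of_mem_wtSpace hV (opF_mem_wtSpace hv s) h0
  have h2 : -(R.refl t ϖ) - R.root s - -ϖ = Finsupp.linearCombination k R.root
      (Finsupp.single t 1 - Finsupp.single s 1) := by
    rw [refl_fundamental hϖ]; simp; abel
  rw [h2] at h1
  obtain ⟨n, hn⟩ := coeff_of_mem_cone h1 s
  simp [hst.symm] at hn
  have : ((n + 1 : ℕ) : k) = 0 := by push_cast; rw [← hn]; simp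
  exact absurd this (by exact_mod_cast Nat.succ_ne_zero n)

theorem opE_lowest_eq_zero {i : I} (hi : i ≠ t) {v : V} (hv : v ∈ wtSpace R V (-ϖ)) :
    R.opE V i v = 0 := by
  by_contra h0
  have h1 : IsWt R V (-ϖ + R.root i) := ⟨_, opE_mem_wtSpace hv i, h0⟩
  have h2 := h1.refl hV hϖ.exists_int i
  rw [map_add, map_neg, refl_fundamental_of_ne hϖ hi, refl_root_self, ← sub_eq_add_neg] at h2
  exact not_isWt_sub hV (R.root_mem_cone i) (R.root_indep.ne_zero i) h2

theorem not_isWt_refl_add {n : ℕ} (hn : n ≠ 0) : ¬ IsWt R V (-(R.refl t ϖ) + n • R.root t) := by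
  intro h
  have h2 := h.refl hV hϖ.exists_int t
  rw [map_add, map_neg, refl_refl, map_nsmul, refl_root_self, smul_neg, ← sub_eq_add_neg] at h2
  refine not_isWt_sub hV (nsmul_mem (R.root_mem_cone t) n) ?_ h2
  rw [← Nat.cast_smul_eq_nsmul k]
  exact smul_ne_zero (by exact_mod_cast hn) (R.root_indep.ne_zero t)

end Driving

/-! ### The driving trail and the first occurrence of `s`. -/

section TrailBasics

variable {k I 𝔥 : Type*} [Field k] [AddCommGroup 𝔥] [Module k 𝔥] {R : Realization k I 𝔥}
  {J : ReducedSeq R} {t : I} {ϖ : Module.Dual k 𝔥} {V : Type*} [AddCommGroup V]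
  [Module k V] [LieRingModule (Alg R) V] [LieModule k (Alg R) V]

open Realization

namespace Trail

theorem mem_wtSpace (K : Trail J t ϖ V) {j : ℕ} (hj : (j : ℕ∞) ≤ J.length) :
    K.vec j ∈ wtSpace R V (K.wt j) := K.weight j hj

theorem wt_succ (K : Trail J t ϖ V) {j : ℕ} (hj : (j : ℕ∞) < J.length) {n : ℕ}
    (hn : (R.opE V (J.letter j) ^ n) (K.vec j) = K.vec (j + 1)) :
    K.wt (j + 1) = K.wt j + n • R.root (J.letter j) :=
  have hj' := ReducedSeq.succ_le_length hj
  (wt_unique (K.vec_ne_zero _ hj') (hn ▸ pow_opE_mem_wtSpace (K.mem_wtSpace hj.le) _ n)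
    (K.mem_wtSpace hj')).symm

end Trail

variable [CharZero k]

theorem nsmul_root_mem_cone_iff {i : I} {z : ℤ} (h : z • R.root i ∈ R.cone) : 0 ≤ z := by
  have h1 : z • R.root i = Finsupp.linearCombination k R.root (Finsupp.single i (z : k)) := by
    simp [Int.cast_smul_eq_zsmul]
  rw [h1] at h
  obtain ⟨n, hn⟩ := coeff_of_mem_cone h i
  rw [Finsupp.single_eq_same] at hn
  have : z = n := by exact_mod_cast hn
  omega

variable (hV : IsIntegrableLowestWeight R V (-ϖ)) (hϖ : IsFundamentalWeight R t ϖ)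

include hV hϖ

/-- A trail which agrees with the driving trail up to the first step of letter `t` is the driving
trail. -/
theorem Trail.isDriving_of_initial (K : Trail J t ϖ V) {p : ℕ} (hp : J.Pos t 1 p)
    (h : ∀ i ≤ p, K.wt i = K.wt 0) : K.IsDriving := by
  intro j hj
  by_cases hjp : j ≤ p
  · rw [h j hjp, K.start, driving_of_forall_ne fun i hi => hp.letter_ne_first (by omega)]
  obtain ⟨d, rfl⟩ : ∃ d, j = p + 1 + d := ⟨j - (p + 1), by omega⟩
  clear hjp
  induction d with
  | zero =>
    obtain ⟨n, hn⟩ := K.step p hp.lt_length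
    have h1 := K.wt_succ hp.lt_length hn
    rw [h p le_rfl, K.start, hp.letter_eq] at h1
    rw [add_zero, driving_of_forall_ne fun i hi => hp.letter_ne_first (by omega), h1]
    by_cases hn0 : n = 0
    · simp [hn0]
    · have hw := K.mem_wtSpace hj
      rw [add_zero, h1] at hw
      exact absurd ⟨_, hw, K.vec_ne_zero _ hj⟩ (not_isWt_refl_add hV hϖ hn0)
  | succ d ih =>
    rw [← add_assoc] at hj ⊢
    set q := p + 1 + d with hq
    have hq' : (q : ℕ∞) < J.length := lt_of_lt_of_le (by exact_mod_cast Nat.lt_succ_self q) hj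
    obtain ⟨n, hn⟩ := K.step q hq'
    have h1 := K.wt_succ hq' hn
    obtain ⟨m, hm⟩ := exists_weyl_coroot hV hϖ hq'
    have hd : J.driving t ϖ q = -(R.weyl J.letter q ϖ) :=
      driving_of_exists hϖ ⟨p, by omega, hp.letter_eq⟩
    have hd' : J.driving t ϖ (q + 1) = -(R.weyl J.letter (q + 1) ϖ) :=
      driving_of_exists hϖ ⟨p, by omega, hp.letter_eq⟩
    have hw : -(R.weyl J.letter (q + 1) ϖ) = -(R.weyl J.letter q ϖ) + m • R.root (J.letter q) := by
      rw [Realization.weyl, Module.End.mul_apply, ← map_neg, refl_apply, hm]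
      module
    rw [ih hq'.le, hd] at h1
    -- Positivity gives `n ≥ m`; an excess `c = n - m > 0` would, after reflection, produce a weight
    -- below the extremal one. Past the last step positivity is not imposed, and `boundary` is used
    -- instead.
    by_cases hl : ((q + 1 : ℕ) : ℕ∞) < J.length
    · have h2 := K.positive _ hl
      rw [hd', hw, h1, add_sub_add_left_eq_sub] at h2
      have h3 : 0 ≤ (n : ℤ) - m := nsmul_root_mem_cone_iff (R := R) (i := J.letter q) (by
        rwa [sub_smul, natCast_zsmul, natCast_zsmul])
      obtain ⟨c, rfl⟩ : ∃ c, n = m + c := ⟨n - m, by omega⟩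
      by_cases hc : c = 0
      · rw [h1, hd', hw, hc, add_zero]
      · have h4 : IsWt R V (K.wt (q + 1)) := ⟨_, K.mem_wtSpace hj, K.vec_ne_zero _ hj⟩
        have h5 := h4.refl hV hϖ.exists_int (J.letter q)
        have h6 : R.refl (J.letter q) (K.wt (q + 1)) =
            -(R.weyl J.letter q ϖ) - c • R.root (J.letter q) := by
          rw [h1, map_add, map_nsmul, refl_root_self, refl_apply, hm]
          module
        rw [h6] at h5
        exact absurd h5 (not_isWt_weyl_sub hV hϖ hq' hc)
    · obtain ⟨m', hm', hb⟩ := K.boundary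
      have h2 : m' < q + 1 := by exact_mod_cast lt_of_lt_of_le hm' (not_lt.1 hl)
      rw [hd']
      exact hb q (by omega) hq'

/-- In a trail, other than the driving trail if `s = t`, the vector before the first step of
letter `s` is killed by `f_s`. -/
theorem Trail.opF_first_eq_zero (K : Trail J t ϖ V) {s : I} (hs : s ≠ t ∨ ¬ K.IsDriving) {p : ℕ}
    (hp : J.Pos s 1 p) : R.opF V s (K.vec p) = 0 := by
  -- Steps before the first `s` commute with `f_s`. If `s = t`, the initial vector lowers to weight
  -- `-ϖ`, where every `e_i` with `i ≠ t` acts as zero: the first nontrivial step makes the lowered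
  -- vector vanish, and without such a step the trail is driving.
  have key : ∀ j ≤ p, R.opF V s (K.vec j) = 0 ∨ (s = t ∧ ∀ i ≤ j, K.wt i = K.wt 0) := by
    intro j
    induction j with
    | zero =>
      intro _
      by_cases hst : s = t
      · exact Or.inr ⟨hst, fun i hi => by rw [Nat.le_zero.1 hi]⟩
      · left
        refine opF_initial_eq_zero hV hϖ hst ?_
        rw [← K.start]
        exact K.mem_wtSpace (by simp)
    | succ j ih =>
      intro hj
      have hjl : (j : ℕ∞) < J.length := lt_trans (by exact_mod_cast hj) hp.lt_length
      have hne := hp.letter_ne_first (i := j) (by omega)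
      obtain ⟨n, hn⟩ := K.step j hjl
      have hn' : R.opF V s (K.vec (j + 1)) = (R.opE V (J.letter j) ^ n) (R.opF V s (K.vec j)) := by
        rw [← hn, pow_opE_opF_of_ne hne]
      obtain h | ⟨rfl, h⟩ := ih (by omega)
      · left
        rw [hn', h, map_zero]
      · rcases n with _ | n
        · right
          refine ⟨rfl, fun i hi => ?_⟩
          obtain rfl | hi := hi.eq_or_lt
          · rw [K.wt_succ hjl hn, zero_smul, add_zero, h j le_rfl]
          · exact h i (by omega)
        · left
          have h1 : R.opF V s (K.vec j) ∈ wtSpace R V (-ϖ) := by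
            have := opF_mem_wtSpace (K.mem_wtSpace hjl.le) s
            rwa [h j le_rfl, K.start, refl_fundamental hϖ, neg_sub, sub_sub_cancel_left] at this
          rw [hn', pow_succ, Module.End.mul_apply, opE_lowest_eq_zero hV hϖ hne h1, map_zero]
  obtain h | ⟨rfl, h⟩ := key p le_rfl
  · exact h
  · obtain hs | hs := hs
    · exact absurd rfl hs
    · exact absurd (K.isDriving_of_initial hV hϖ hp h) hs

/-- The driving trail is not killed by `f_t` at the first step of letter `t`. -/
theorem Trail.not_isDriving_of_opF_eq_zero (K : Trail J t ϖ V) {p : ℕ} (hp : J.Pos t 1 p)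
    (h : R.opF V t (K.vec p) = 0) : ¬ K.IsDriving := by
  intro hd
  have h1 := K.mem_wtSpace hp.lt_length.le
  rw [hd p hp.lt_length.le, driving_of_forall_ne fun i hi => hp.letter_ne_first (by omega)] at h1
  refine pow_opF_ne_zero hV h1 (K.vec_ne_zero _ hp.lt_length.le) (i := t) (m := 1) ?_ (by simpa using h)
  rw [refl_fundamental hϖ, neg_sub, LinearMap.sub_apply, root_coroot_self, hϖ t, if_pos rfl]
  norm_num

end TrailBasics

/-! ### Removing one face. -/

section Removal

variable {k I 𝔥 : Type*} [Field k] [CharZero k] [AddCommGroup 𝔥] [Module k 𝔥]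
  {R : Realization k I 𝔥} {J : ReducedSeq R} {t : I} {ϖ : Module.Dual k 𝔥} {V : Type*}
  [AddCommGroup V] [Module k V] [LieRingModule (Alg R) V] [LieModule k (Alg R) V]

open Realization

/-- The trail `K` lies in `T_s^+`, is minimal up to the `κ`-th occurrence of `s` and maximal beyond
it. -/
structure MinimalUpTo (s : I) (n : ℕ) (v₀ : V) (a : ℕ → ℕ) (κ : ℕ) (K : Trail J t ϖ V) : Prop where
  mem : K ∈ TPlus J t ϖ s n v₀ a
  min : ∀ m ≤ κ, ∀ j, J.Pos s m j → R.opF V s (K.vec j) = 0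
  max : ∀ m, κ < m → ∀ j, J.Pos s m j → R.opE V s (K.vec (j + 1)) = 0

theorem MinimalUpTo.exists_removeFace (hV : IsIntegrableLowestWeight R V (-ϖ))
    (hϖ : IsFundamentalWeight R t ϖ) {s : I} {n : ℕ} {v₀ : V} {a : ℕ → ℕ} {κ u v : ℕ}
    {K : Trail J t ϖ V} (hK : MinimalUpTo s n v₀ a κ K) (hκ : 1 ≤ κ) (hκn : κ + 1 ≤ n)
    (hu : J.Pos s κ u) (hv : J.Pos s (κ + 1) v) (hF : R.opF V s (K.vec v) ≠ 0) :
    ∃ K' : Trail J t ϖ V, MinimalUpTo s n v₀ a κ K' ∧ K.RemoveFace K' s (κ + 1) ∧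
      ∀ j, K'.wt j = K.wt j - J.face s (κ + 1) j := by
  obtain ⟨hdr, hv₀, p, hp, htriv, hexp⟩ := hK.mem
  have huv : u < v := hu.lt_of_lt hv (Nat.lt_succ_self κ)
  have hvp : v ≤ p := by
    obtain h | h := hκn.eq_or_lt
    · rw [h] at hv; exact (hv.unique hp).le
    · exact (hv.lt_of_lt hp h).le
  have hlen : ∀ {i}, i ≤ v → (i : ℕ∞) < J.length := fun hi =>
    lt_of_le_of_lt (by exact_mod_cast hi) hv.lt_length
  have S := sl2Ops R V s
  obtain ⟨nv, hnv⟩ := K.step v hv.lt_length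
  rw [hv.letter_eq] at hnv
  have hE : R.opE V s ((R.opE V s ^ nv) (K.vec v)) = 0 := by
    rw [hnv]; exact hK.max _ (Nat.lt_succ_self κ) v hv
  have hne0 : (R.opE V s ^ nv) (K.vec v) ≠ 0 := by
    rw [hnv]; exact K.vec_ne_zero _ (ReducedSeq.succ_le_length hv.lt_length)
  have hwv := K.mem_wtSpace hv.lt_length.le (R.coroot s)
  have hcomm : ∀ i, u < i → i < v → ∀ m, (R.opE V (J.letter i) ^ m) (K.vec i) = K.vec (i + 1) →
      (R.opE V (J.letter i) ^ m) (R.opF V s (K.vec i)) = R.opF V s (K.vec (i + 1)) :=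
    fun i h1 h2 m hm => by rw [pow_opE_opF_of_ne (hu.letter_ne hv h1 h2), hm]
  have hFne : ∀ i, u < i → i ≤ v → R.opF V s (K.vec i) ≠ 0 := by
    intro i h1 h2
    induction h2 using Nat.decreasingInduction with
    | self => exact hF
    | of_succ i hi ih =>
      obtain ⟨m, hm⟩ := K.step i (hlen hi.le)
      intro h
      refine ih (by omega) ?_
      rw [← hcomm i h1 hi m hm, h, map_zero]
  obtain ⟨nu, hnu⟩ := K.step u hu.lt_length
  rw [hu.letter_eq] at hnu
  have hFu : R.opF V s (K.vec u) = 0 := hK.min κ le_rfl u hu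
  have hFu1 := hFne (u + 1) (by omega) huv
  -- A zero exponent at `u` would give `vec (u + 1) = vec u`, which `f_s` kills; so there is an
  -- `e_s` to give up at `u`.
  rcases nu with _ | nu
  · rw [← hnu] at hFu1
    exact absurd hFu hFu1
  obtain ⟨c, hc⟩ : ∃ c : k, R.opF V s (K.vec (u + 1)) = c • (R.opE V s ^ nu) (K.vec u) :=
    ⟨_, by rw [← hnu, S.f_pow_e (K.mem_wtSpace hu.lt_length.le (R.coroot s)) hFu]⟩
  have hc0 : c ≠ 0 := by
    rintro rfl
    rw [zero_smul] at hc
    exact hFu1 hc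
  obtain ⟨b, hb0, hb⟩ : ∃ b : k, b ≠ 0 ∧
      (R.opE V s ^ (nv + 1)) (R.opF V s (K.vec v)) = b • K.vec (v + 1) := by
    refine ⟨((nv : k) + 1) * (K.wt v (R.coroot s) + nv), ?_, ?_⟩
    · refine mul_ne_zero (by exact_mod_cast Nat.succ_ne_zero nv) fun h => hF ?_
      exact (S.f_eq_zero_iff (hV.f_nilpotent s) hwv hne0 hE).2 h
    · rw [S.pow_e_f hwv, pow_succ', Module.End.mul_apply, hE, map_zero, zero_add, hnv]
  have hface := fun j => ReducedSeq.face_eq hu hv j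
  -- The factor `c⁻¹` makes the step at `u` exactly `e_s ^ nu`, and the factor `b` then makes the
  -- step at `v` exactly `e_s ^ (nv + 1)`. All other exponents are unchanged.
  let vec : ℕ → V := fun j => if j ≤ u then K.vec j else
    if j ≤ v then c⁻¹ • R.opF V s (K.vec j) else (c⁻¹ * b) • K.vec j
  have vec1 : ∀ j, j ≤ u → vec j = K.vec j := fun j h => if_pos h
  have vec2 : ∀ j, u < j → j ≤ v → vec j = c⁻¹ • R.opF V s (K.vec j) := fun j h h' => by
    simp only [vec, if_neg (not_le.2 h), if_pos h']
  have vec3 : ∀ j, v < j → vec j = (c⁻¹ * b) • K.vec j := fun j h => by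
    simp only [vec, if_neg (not_le.2 (huv.trans h)), if_neg (not_le.2 h)]
  have hcommon : ∀ i, i ≠ u → i ≠ v → ∀ m, (R.opE V (J.letter i) ^ m) (K.vec i) = K.vec (i + 1) →
      (R.opE V (J.letter i) ^ m) (vec i) = vec (i + 1) := by
    intro i h1 h2 m hm
    obtain h | h := h1.lt_or_gt
    · rw [vec1 _ h.le, vec1 _ h, hm]
    obtain h' | h' := h2.lt_or_gt
    · rw [vec2 _ h h'.le, vec2 _ (by omega) h', map_smul, hcomm i h h' m hm]
    · rw [vec3 _ h', vec3 _ (by omega), map_smul, hm]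
  have hvec0 : ∀ j : ℕ, (j : ℕ∞) ≤ J.length → vec j ≠ 0 := by
    intro j hj
    obtain h | h := le_or_gt j u
    · rw [vec1 _ h]; exact K.vec_ne_zero j hj
    obtain h' | h' := le_or_gt j v
    · rw [vec2 _ h h']; exact smul_ne_zero (inv_ne_zero hc0) (hFne j h h')
    · rw [vec3 _ h']
      exact smul_ne_zero (mul_ne_zero (inv_ne_zero hc0) hb0) (K.vec_ne_zero j hj)
  have hwt : ∀ j : ℕ, (j : ℕ∞) ≤ J.length →
      vec j ∈ wtSpace R V (K.wt j - J.face s (κ + 1) j) := by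
    intro j hj
    rw [hface]
    obtain h | h := le_or_gt j u
    · rw [vec1 _ h, if_neg (by omega), sub_zero]; exact K.mem_wtSpace hj
    obtain h' | h' := le_or_gt j v
    · rw [vec2 _ h h', if_pos ⟨h, h'⟩]
      exact Submodule.smul_mem _ _ (opF_mem_wtSpace (K.mem_wtSpace hj) s)
    · rw [vec3 _ h', if_neg (by omega), sub_zero]
      exact Submodule.smul_mem _ _ (K.mem_wtSpace hj)
  have hstep : ∀ j : ℕ, (j : ℕ∞) < J.length →
      ∃ m : ℕ, (R.opE V (J.letter j) ^ m) (vec j) = vec (j + 1) := by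
    intro j hj
    by_cases h1 : j = u
    · refine ⟨nu, ?_⟩
      rw [h1, vec1 _ le_rfl, vec2 _ (by omega) huv, hc, smul_smul, inv_mul_cancel₀ hc0, one_smul,
        hu.letter_eq]
    by_cases h2 : j = v
    · refine ⟨nv + 1, ?_⟩
      rw [h2, vec2 _ huv le_rfl, vec3 _ (by omega), hv.letter_eq, map_smul, hb, mul_smul]
    · obtain ⟨m, hm⟩ := K.step j hj
      exact ⟨m, hcommon j h1 h2 m hm⟩
  have hstart : K.wt 0 - J.face s (κ + 1) 0 = -(R.refl t ϖ) := by
    rw [hface, if_neg (by omega), sub_zero, K.start]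
  have hend : ∀ j : ℕ, p ≤ j → (j : ℕ∞) < J.length →
      K.wt (j + 1) - J.face s (κ + 1) (j + 1) = -(R.weyl J.letter (j + 1) ϖ) := by
    intro j hj hjl
    rw [hface, if_neg (by omega), sub_zero, htriv j hj hjl]
  let K' : Trail J t ϖ V :=
    { vec := vec
      wt := fun j => K.wt j - J.face s (κ + 1) j
      vec_ne_zero := hvec0
      weight := hwt
      step := hstep
      start := hstart
      boundary := ⟨p, hp.lt_length, hend⟩
      positive := fun j hj =>
        sub_driving_mem_cone hV hϖ hp.lt_length hvec0 hwt hstep hstart hend hj }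
  have hmin : ∀ m ≤ κ, ∀ j, J.Pos s m j → R.opF V s (K'.vec j) = 0 := by
    intro m hm j hj
    have hju : j ≤ u := by
      obtain rfl | h := hm.eq_or_lt
      · exact (hj.unique hu).le
      · exact (hj.lt_of_lt hu h).le
    have := hK.min m hm j hj
    rwa [← vec1 j hju] at this
  refine ⟨K', ⟨⟨?_, ?_, p, hp, hend, ?_⟩, hmin, ?_⟩, ⟨by omega, ⟨v, hv⟩, fun j _ => ?_⟩,
    fun j => rfl⟩
  -- For `s = t`, minimality at the first occurrence, kept because `κ ≥ 1`, rules out the driving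
  -- trail.
  · by_cases hst : s = t
    · right
      subst hst
      obtain ⟨p₁, -, hp₁⟩ := hu.exists_le (m := 1) le_rfl hκ
      exact K'.not_isDriving_of_opF_eq_zero hV hϖ hp₁ (hmin 1 hκ _ hp₁)
    · exact Or.inl hst
  · exact (vec1 0 (by omega)).trans hv₀
  · intro i hi hs
    refine hcommon i ?_ ?_ (a i) (hexp i hi hs)
    · rintro rfl; exact hs hu.letter_eq
    · rintro rfl; exact hs hv.letter_eq
  · intro m hm j hj
    have hvj : v ≤ j := by
      obtain h | h := (Nat.succ_le_of_lt hm).eq_or_lt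
      · rw [← h] at hj; exact (hv.unique hj).le
      · exact (hv.lt_of_lt hj h).le
    change R.opE V s (vec (j + 1)) = 0
    rw [vec3 _ (by omega), map_smul, hK.max m hm j hj, smul_zero]
  · exact (sub_add_cancel _ _).symm

end Removal

/-! ### From a maximal to a minimal trail. -/

section Minimax

variable {k I 𝔥 : Type*} [Field k] [AddCommGroup 𝔥] [Module k 𝔥]
  {R : Realization k I 𝔥} {J : ReducedSeq R} {t : I} {ϖ : Module.Dual k 𝔥} {V : Type*}
  [AddCommGroup V] [Module k V] [LieRingModule (Alg R) V] [LieModule k (Alg R) V]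

open Realization

/-- `K'` is obtained from `K` by successively removing, inside `T`, faces `F_s^{κ' + 1}` with `κ'`
weakly increasing and at least `κ`. -/
inductive FaceRemovals (T : Set (Trail J t ϖ V)) (s : I) : ℕ → Trail J t ϖ V → Trail J t ϖ V → Prop
  | refl (κ : ℕ) (K : Trail J t ϖ V) (hK : K ∈ T) : FaceRemovals T s κ K K
  | step (κ κ' : ℕ) (K K₁ K' : Trail J t ϖ V) (hκ : κ ≤ κ') (h1 : 1 ≤ κ') (hK : K ∈ T)
      (hr : K.RemoveFace K₁ s (κ' + 1)) (h : FaceRemovals T s κ' K₁ K') : FaceRemovals T s κ K K'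

theorem FaceRemovals.mono {T : Set (Trail J t ϖ V)} {s : I} {κ κ₀ : ℕ} {K K' : Trail J t ϖ V}
    (h : FaceRemovals T s κ K K') (hκ : κ₀ ≤ κ) : FaceRemovals T s κ₀ K K' := by
  cases h with
  | refl κ K hK => exact .refl _ _ hK
  | step κ κ' K K₁ K' h0 h1 hK hr h => exact .step _ κ' _ _ _ (hκ.trans h0) h1 hK hr h

theorem FaceRemovals.exists_sequence {T : Set (Trail J t ϖ V)} {s : I} {κ : ℕ}
    {K K' : Trail J t ϖ V} (h : FaceRemovals T s κ K K') :
    ∃ (r : ℕ) (L : ℕ → Trail J t ϖ V) (g : ℕ → ℕ), L 0 = K ∧ L r = K' ∧ Monotone g ∧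
      (∀ a ≤ r, L a ∈ T) ∧ (∀ a < r, 1 ≤ g a ∧ (L a).RemoveFace (L (a + 1)) s (g a + 1)) ∧
      ∀ a, κ ≤ g a := by
  induction h with
  | refl κ K hK => exact ⟨0, fun _ => K, fun _ => κ, rfl, rfl, monotone_const, fun _ _ => hK,
      fun _ h => absurd h (Nat.not_lt_zero _), fun _ => le_rfl⟩
  | step κ κ' K K₁ K' hκ h1 hK hr _ ih =>
    obtain ⟨r, L, g, hL0, hLr, hg, hT, hL, hgκ⟩ := ih
    refine ⟨r + 1, fun a => Nat.casesOn a K L, fun a => Nat.casesOn a κ' g, rfl, hLr,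
      monotone_nat_of_le_succ ?_, ?_, ?_, ?_⟩
    · rintro (_ | a)
      · exact hgκ 0
      · exact hg (Nat.le_succ a)
    · rintro (_ | a) ha
      · exact hK
      · exact hT a (by omega)
    · rintro (_ | a) ha
      · refine ⟨h1, ?_⟩
        change K.RemoveFace (L 0) s (κ' + 1)
        rwa [hL0]
      · exact hL a (by omega)
    · rintro (_ | a)
      · exact hκ
      · exact hκ.trans (hgκ a)

theorem FaceRemovals.obtainedByRemovingFaces {T : Set (Trail J t ϖ V)} {s : I} {κ : ℕ}
    {K K' : Trail J t ϖ V} (h : FaceRemovals T s κ K K') : ObtainedByRemovingFaces T s K K' := by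
  obtain ⟨r, L, g, hL0, hLr, hg, hT, hL, -⟩ := h.exists_sequence
  exact ⟨r, L, g, hL0, hLr, hg, hT, hL⟩

namespace Trail

theorem d_eq (K : Trail J t ϖ V) {s : I} {m j : ℕ} (hj : J.Pos s m j) :
    K.d s m = (2 : k)⁻¹ * (K.wt j (R.coroot s) + K.wt (j + 1) (R.coroot s)) := by
  have H : ∃ j, J.Pos s m j := ⟨j, hj⟩
  rw [d, dif_pos H, H.choose_spec.unique hj, LinearMap.smul_apply, LinearMap.add_apply, smul_eq_mul]

theorem d_eq_zero (K : Trail J t ϖ V) {s : I} {m : ℕ} (h : ∀ j, ¬ J.Pos s m j) : K.d s m = 0 :=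
  dif_neg (by push Not; exact h)

end Trail

variable [CharZero k]

theorem Trail.exists_d_eq_nat (hV : IsIntegrableLowestWeight R V (-ϖ)) (K : Trail J t ϖ V) {s : I}
    {m j : ℕ} (hj : J.Pos s m j) (hE : R.opE V s (K.vec (j + 1)) = 0) :
    (∃ x : ℕ, K.d s m = x) ∧ (R.opF V s (K.vec j) = 0 ↔ K.d s m = 0) := by
  obtain ⟨n, hn⟩ := K.step j hj.lt_length
  have hw := K.wt_succ hj.lt_length hn
  rw [hj.letter_eq] at hn hw
  have hd : K.d s m = K.wt j (R.coroot s) + n := by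
    rw [K.d_eq hj, hw, LinearMap.add_apply, LinearMap.smul_apply, root_coroot_self]
    simp only [nsmul_eq_mul]
    ring
  have h0 : (R.opE V s ^ n) (K.vec j) ≠ 0 := by
    rw [hn]; exact K.vec_ne_zero _ (ReducedSeq.succ_le_length hj.lt_length)
  have h1 : R.opE V s ((R.opE V s ^ n) (K.vec j)) = 0 := by rw [hn, hE]
  have hwv := K.mem_wtSpace hj.lt_length.le (R.coroot s)
  rw [hd]
  exact ⟨(sl2Ops R V s).exists_nat_add (hV.f_nilpotent s) hwv h0 h1,
    (sl2Ops R V s).f_eq_zero_iff (hV.f_nilpotent s) hwv h0 h1⟩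

/-- Beyond the trivializing step the weights around a step of letter `s` are exchanged by `s_s`, so
their mean vanishes on `α_s^∨`. -/
theorem Trail.d_eq_zero_of_trivializesAt (K : Trail J t ϖ V) {s : I} {n p m : ℕ}
    (hp : J.Pos s n p) (hK : K.TrivializesAt p) (hm : n < m) : K.d s m = 0 := by
  by_cases h : ∃ j, J.Pos s m j
  · obtain ⟨j, hj⟩ := h
    have hpj := hp.lt_of_lt hj hm
    obtain ⟨i, rfl⟩ : ∃ i, j = i + 1 := ⟨j - 1, by omega⟩
    rw [K.d_eq hj, hK (i + 1) (by omega) hj.lt_length,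
      hK i (by omega) (lt_of_le_of_lt (by exact_mod_cast Nat.le_succ i) hj.lt_length),
      show R.weyl J.letter (i + 1 + 1) = R.refl (J.letter (i + 1)) * R.weyl J.letter (i + 1) from rfl,
      Module.End.mul_apply, refl_apply, hj.letter_eq]
    simp only [LinearMap.neg_apply, LinearMap.sub_apply, LinearMap.smul_apply, root_coroot_self,
      smul_eq_mul]
    ring
  · push Not at h
    exact K.d_eq_zero h

variable (hV : IsIntegrableLowestWeight R V (-ϖ)) (hϖ : IsFundamentalWeight R t ϖ)

include hV hϖ

/-- Double induction: on `e = n - κ`, and inside it on the natural number `d_{κ+1}(K)`, which each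
removal of `F_s^{κ+1}` lowers by one. When it reaches zero, `K` is minimal at the next occurrence
too. The multiplicities `x m` are the values `d_{m+1}` of the starting trail. -/
theorem MinimalUpTo.exists_minimal {s : I} {n p : ℕ} {v₀ : V} {a : ℕ → ℕ} (hp : J.Pos s n p)
    (e : ℕ) {κ : ℕ} (hκ : 1 ≤ κ) (he : κ + e = n) {K : Trail J t ϖ V}
    (hK : MinimalUpTo s n v₀ a κ K) :
    ∃ Kmin : Trail J t ϖ V, MinimalUpTo s n v₀ a n Kmin ∧
      FaceRemovals (TPlus J t ϖ s n v₀ a) s κ K Kmin ∧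
      ∃ x : ℕ → ℕ, (∀ m, κ ≤ m → m < n → K.d s (m + 1) = x m) ∧
        ∀ j, K.wt j = Kmin.wt j + ∑ m ∈ Finset.Ico κ n, x m • J.face s (m + 1) j := by
  induction e generalizing κ K with
  | zero =>
    obtain rfl : κ = n := he
    exact ⟨K, hK, .refl _ _ hK.mem, 0, fun m h1 h2 => absurd h1 (by omega), fun j => by simp⟩
  | succ e ih =>
    have hκn : κ < n := by omega
    obtain ⟨v, hvp, hv⟩ := hp.exists_le (m := κ + 1) (by omega) hκn
    obtain ⟨u, huv, hu⟩ := hv.exists_pred hκ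
    obtain ⟨⟨y, hy⟩, -⟩ := K.exists_d_eq_nat hV hv (hK.max _ (Nat.lt_succ_self κ) v hv)
    induction y generalizing K with
    | zero =>
      have hF : R.opF V s (K.vec v) = 0 :=
        (K.exists_d_eq_nat hV hv (hK.max _ (Nat.lt_succ_self κ) v hv)).2.2 (by simpa using hy)
      have hK' : MinimalUpTo s n v₀ a (κ + 1) K := by
        refine ⟨hK.mem, fun m hm j hj => ?_, fun m hm => hK.max m (by omega)⟩
        obtain rfl | hm := hm.eq_or_lt
        · rwa [hj.unique hv]
        · exact hK.min m (by omega) j hj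
      obtain ⟨Kmin, h1, h2, x, h3, h4⟩ := ih (by omega) (by omega) hK'
      refine ⟨Kmin, h1, h2.mono (Nat.le_succ κ), Function.update x κ 0, fun m hm hmn => ?_,
        fun j => ?_⟩
      · obtain rfl | hm := hm.eq_or_lt
        · simpa using hy
        · rw [Function.update_of_ne (by omega), h3 m hm hmn]
      · rw [h4 j, Finset.sum_eq_sum_Ico_succ_bot hκn, Function.update_self, zero_smul, zero_add]
        congr 1
        refine Finset.sum_congr rfl fun m hm => ?_
        rw [Finset.mem_Ico] at hm
        rw [Function.update_of_ne (by omega)]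
    | succ y ihy =>
      have hF : R.opF V s (K.vec v) ≠ 0 := fun hF => by
        have := (K.exists_d_eq_nat hV hv (hK.max _ (Nat.lt_succ_self κ) v hv)).2.1 hF
        rw [hy] at this
        exact absurd this (by exact_mod_cast Nat.succ_ne_zero y)
      obtain ⟨K₁, hK₁, hr, hwt⟩ := hK.exists_removeFace hV hϖ hκ hκn hu hv hF
      have hd : K₁.d s (κ + 1) = y := by
        have h1 : K₁.d s (κ + 1) = K.d s (κ + 1) - 1 := by
          rw [K₁.d_eq hv, K.d_eq hv, hwt, hwt, ReducedSeq.face_eq hu hv, ReducedSeq.face_eq hu hv,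
            if_pos ⟨huv, le_rfl⟩, if_neg (by omega), LinearMap.sub_apply, root_coroot_self]
          simp only [sub_zero]
          ring
        rw [h1, hy]; push_cast; ring
      have hd' : ∀ m, κ < m → K₁.d s (m + 1) = K.d s (m + 1) := by
        intro m hm
        by_cases h : ∃ j, J.Pos s (m + 1) j
        · obtain ⟨j, hj⟩ := h
          have hvj := hv.lt_of_lt hj (by omega)
          rw [K₁.d_eq hj, K.d_eq hj, hwt, hwt, ReducedSeq.face_eq hu hv, ReducedSeq.face_eq hu hv,
            if_neg (by omega), if_neg (by omega), sub_zero, sub_zero]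
        · push Not at h
          rw [K₁.d_eq_zero h, K.d_eq_zero h]
      obtain ⟨Kmin, h1, h2, x, h3, h4⟩ := ihy hK₁ hd
      refine ⟨Kmin, h1, .step _ κ _ K₁ _ le_rfl hκ hK.mem hr h2,
        Function.update x κ (x κ + 1), fun m hm hmn => ?_, fun j => ?_⟩
      · obtain rfl | hm := hm.eq_or_lt
        · have h5 := h3 κ le_rfl hκn
          rw [hd] at h5
          rw [hy, Function.update_self]; push_cast; rw [h5]
        · rw [Function.update_of_ne (by omega), ← h3 m hm.le hmn, hd' m hm]
      · have h5 := h4 j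
        rw [hwt j, sub_eq_iff_eq_add] at h5
        rw [h5, Finset.sum_eq_sum_Ico_succ_bot hκn, Finset.sum_eq_sum_Ico_succ_bot hκn,
          Function.update_self, succ_nsmul]
        have h6 : ∀ m ∈ Finset.Ico (κ + 1) n, Function.update x κ (x κ + 1) m = x m := fun m hm =>
          Function.update_of_ne (by rw [Finset.mem_Ico] at hm; omega) _ _
        have h7 : ∑ m ∈ Finset.Ico (κ + 1) n,
            Function.update x κ (x κ + 1) m • J.face s (m + 1) j =
              ∑ m ∈ Finset.Ico (κ + 1) n, x m • J.face s (m + 1) j :=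
          Finset.sum_congr rfl fun m hm => by rw [h6 m hm]
        rw [h7]
        abel

end Minimax

end

end Trails

/-! ### The minimax theorem. -/

theorem theorem4p7p4 {k I 𝔥 V : Type*} [Field k] [CharZero k] [AddCommGroup 𝔥] [Module k 𝔥]
    (R : Trails.Realization k I 𝔥) (J : Trails.ReducedSeq R)
    (t : I) (ϖ : Module.Dual k 𝔥) (hϖ : Trails.IsFundamentalWeight R t ϖ)
    [AddCommGroup V] [Module k V] [LieRingModule (Trails.Alg R) V]
    [LieModule k (Trails.Alg R) V] (hV : Trails.IsIntegrableLowestWeight R V (-ϖ))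
    (s : I) (n : ℕ) (v₀ : V) (a : ℕ → ℕ)
    (Kmax : Trails.Trail J t ϖ V) (hK : Kmax ∈ Trails.TPlus J t ϖ s n v₀ a)
    (hmax : Kmax.IsMaximal s) :
    ∃ Kmin ∈ Trails.TPlus J t ϖ s n v₀ a, Kmin.IsMinimal s ∧
      Trails.ObtainedByRemovingFaces (Trails.TPlus J t ϖ s n v₀ a) s Kmax Kmin ∧
      (∀ m : ℕ, Kmax.d s (m + 1) = Kmin.c s m) ∧
      (∀ m : ℕ, ∃ q : ℕ, Kmin.c s m = (q : k)) ∧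
      ∃ N : ℕ, (∀ m : ℕ, N < m → Kmin.c s m = 0) ∧
        ∀ j : ℕ, (j : ℕ∞) ≤ J.length →
          Kmax.wt j = Kmin.wt j + ∑ m ∈ Finset.Icc 1 N, Kmin.c s m • J.face s (m + 1) j := by
  obtain ⟨hdr, hv₀, p, hp, htriv, hexp⟩ := hK
  have hK : Kmax ∈ Trails.TPlus J t ϖ s n v₀ a := ⟨hdr, hv₀, p, hp, htriv, hexp⟩
  obtain ⟨p₁, -, hp₁⟩ := hp.exists_le (m := 1) le_rfl hp.one_le
  have hF₁ := Kmax.opF_first_eq_zero hV hϖ hdr hp₁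
  have hK1 : Trails.MinimalUpTo s n v₀ a 1 Kmax := by
    refine ⟨hK, fun m hm j hj => ?_, fun m _ j hj => hmax m j hj⟩
    obtain rfl : m = 1 := le_antisymm hm hj.one_le
    rwa [hj.unique hp₁]
  have hd₁ : Kmax.d s 1 = 0 := (Kmax.exists_d_eq_nat hV hp₁ (hmax 1 p₁ hp₁)).2.1 hF₁
  obtain ⟨Kmin, hmin, hrem, x, hx, hwt⟩ := hK1.exists_minimal hV hϖ hp (n - 1) le_rfl
    (by have := hp.one_le; omega)
  have hmtriv : Kmin.TrivializesAt p := by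
    obtain ⟨-, -, p', hp', h, -⟩ := hmin.mem
    rwa [hp'.unique hp] at h
  have hc : ∀ m, Kmin.c s m = ((if 1 ≤ m ∧ m < n then x m else 0 : ℕ) : k) := by
    intro m
    rw [Trails.Trail.c]
    by_cases hm0 : m = 0
    · rw [hm0, Kmin.d_eq_zero fun j hj => absurd hj.one_le (by omega)]; simp
    by_cases hmn : n < m
    · rw [Kmin.d_eq_zero_of_trivializesAt hp hmtriv hmn, if_neg (by omega)]; simp
    obtain ⟨j, -, hj⟩ := hp.exists_le (m := m) (by omega) (by omega)
    -- The face `F_s^{l+1}` meets the vector after the `l`-th occurrence and the vector before the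
    -- next one, and no other vector adjacent to a step of letter `s`; each time `α_s^∨` takes the
    -- value 2.
    have hface : ∀ l ∈ Finset.Ico 1 n,
        (x l • J.face s (l + 1) j) (R.coroot s) + (x l • J.face s (l + 1) (j + 1)) (R.coroot s) =
          (if m - 1 = l then 2 * (x l : k) else 0) + if m = l then 2 * (x l : k) else 0 := by
      intro l hl
      rw [Finset.mem_Ico] at hl
      obtain ⟨v, -, hv⟩ := hp.exists_le (m := l + 1) (by omega) hl.2
      obtain ⟨u, -, hu⟩ := hv.exists_pred hl.1
      have e1 : (u < j ∧ j ≤ v) ↔ m - 1 = l := by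
        constructor
        · rintro ⟨h1, h2⟩
          have h3 := hu.lt_of_index_lt hj h1
          have h4 : ¬ l + 1 < m := fun h => absurd (hv.lt_of_lt hj h) (by omega)
          omega
        · intro h
          obtain rfl : m = l + 1 := by omega
          obtain rfl := hj.unique hv
          exact ⟨hu.lt_of_lt hv (by omega), le_rfl⟩
      have e2 : (u < j + 1 ∧ j + 1 ≤ v) ↔ m = l := by
        constructor
        · rintro ⟨h1, h2⟩
          have h3 := hj.lt_of_index_lt hv h2
          have h4 : ¬ m < l := fun h => absurd (hj.lt_of_lt hu h) (by omega)
          omega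
        · rintro rfl
          obtain rfl := hj.unique hu
          exact ⟨by omega, hj.lt_of_lt hv (by omega)⟩
      rw [Trails.ReducedSeq.face_eq hu hv, Trails.ReducedSeq.face_eq hu hv]
      simp only [e1, e2, LinearMap.smul_apply]
      congr 1 <;> split_ifs <;> simp [R.root_coroot_self, mul_comm]
    -- In effect `d_m(Kmax) = d_m(Kmin) + x_{m-1} + x_m`; since the left side is `x_{m-1}`, this
    -- gives `c_m(Kmin) = x_m`, with `x` read as zero outside `1 ≤ m < n`.
    have hd : Kmax.d s m = Kmin.d s m + (2 : k)⁻¹ * ∑ l ∈ Finset.Ico 1 n,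
        ((if m - 1 = l then 2 * (x l : k) else 0) + if m = l then 2 * (x l : k) else 0) := by
      rw [← Finset.sum_congr rfl hface, Finset.sum_add_distrib, Kmax.d_eq hj, Kmin.d_eq hj, hwt,
        hwt (j + 1)]
      simp only [LinearMap.add_apply, LinearMap.sum_apply]
      ring
    rw [Finset.sum_add_distrib, Finset.sum_ite_eq, Finset.sum_ite_eq] at hd
    simp only [Finset.mem_Ico] at hd
    have hdmax : Kmax.d s m = if 1 ≤ m - 1 ∧ m - 1 < n then (x (m - 1) : k) else 0 := by
      by_cases hm1 : m = 1
      · rw [hm1, hd₁, if_neg (by omega)]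
      · obtain ⟨l, rfl⟩ : ∃ l, m = l + 1 := ⟨m - 1, by omega⟩
        rw [if_pos (by omega), hx l (by omega) (by omega), Nat.add_sub_cancel]
    have h2 : ∀ (P Q : Prop) [Decidable P] [Decidable Q] (y z : k), (2 : k)⁻¹ * ((if P then 2 * y else 0) +
        if Q then 2 * z else 0) = (if P then y else 0) + if Q then z else 0 := by
      intro P Q _ _ y z
      split_ifs <;> field_simp <;> ring
    rw [hdmax, h2] at hd
    rw [Nat.cast_ite, Nat.cast_zero]
    linear_combination hd
  refine ⟨Kmin, hmin.mem, ?_, hrem.obtainedByRemovingFaces, ?_, fun m => ⟨_, hc m⟩, n - 1, ?_, ?_⟩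
  · intro m j hj
    by_cases hm : m ≤ n
    · exact hmin.min m hm j hj
    -- Beyond `(s,n)` the trail is still maximal and `d_m = 0`, so it is minimal there as well.
    · exact (Kmin.exists_d_eq_nat hV hj (hmin.max m (by omega) j hj)).2.2
        (Kmin.d_eq_zero_of_trivializesAt hp hmtriv (by omega))
  · intro m
    rw [hc m]
    by_cases hm0 : m = 0
    · simpa [hm0] using hd₁
    by_cases hmn : m < n
    · rw [if_pos (by omega), hx m (by omega) hmn]
    · rw [if_neg (by omega), Kmax.d_eq_zero_of_trivializesAt hp htriv (by omega), Nat.cast_zero]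
  · intro m hm
    rw [hc m, if_neg (by omega), Nat.cast_zero]
  · intro j _
    rw [hwt j]
    have hI : Finset.Ico 1 n = Finset.Icc 1 (n - 1) := by
      ext m; simp only [Finset.mem_Ico, Finset.mem_Icc]; have := hp.one_le; omega
    rw [hI]
    congr 1
    refine Finset.sum_congr rfl fun m hm => ?_
    rw [Finset.mem_Icc] at hm
    rw [hc m, if_pos (by omega), Nat.cast_smul_eq_nsmul]
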